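/- Let $p_1\neq p_2$ and $q$ be primes with $p_1\equiv p_2\equiv 1\pmod 4$ and $q\equiv 3\pmod 4$. Put $k=\mathbb{Q}(\sqrt{p_1p_2q},i)$, $K_1=k(\sqrt{p_1})=\mathbb{Q}(\sqrt{p_1},\sqrt{p_2q},i)$ and $K_1^+=\mathbb{Q}(\sqrt{p_1},\sqrt{p_2q})$; then $K_1$ is a CM-field with maximal real subfield $K_1^+$. For a number field $F$ let $E_F$ be the unit group of its ring of integers and $W_F$ its group of roots of unity; a fundamental system of units (F.S.U.) of $F$ is a finite family $(u_1,\dots,u_r)$ in $E_F$ such that every element of $E_F$ is uniquely of the form $\zeta u_1^{n_1}\cdots u_r^{n_r}$ with $\zeta\in W_F$, $n_j\in\mathbb{Z}$. Let $Q_{K_1}=[E_{K_1}:W_{K_1}E_{K_1^+}]$ be the Hasse unit index, and let $\epsilon_m>1$ denote the fundamental unit of $\mathbb{Q}(\sqrt m)$. Write $\epsilon_{p_2q}=a+b\sqrt{p_2q}$ and $\epsilon_{p_1p_2q}=x+y\sqrt{p_1p_2q}$ with $a,b,x,y\in\mathbb{Q}$. For a positive integer $c$ and $z\in\{a,x\}$,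 say that "$c(z\pm1)$ is a square" if $c(z+1)$ or $c(z-1)$ is the square of a natural number, and that it is not a square if neither is; the signs for $a$ and for $x$ are independent. The square roots below are arbitrary choices of complex square roots, and part of the claim is that those which occur lie in the field in question. Then: 1. If $a\pm1$ is a square and ($x\pm1$ or $p_1(x\pm1)$ is a square), then $\{\epsilon_{p_1},\epsilon_{p_2q},\sqrt{\epsilon_{p_2q}\epsilon_{p_1p_2q}}\}$ is an F.S.U. of $K_1^+$, $\{\epsilon_{p_1},\sqrt{i\epsilon_{p_2q}},\sqrt{\epsilon_{p_2q}\epsilon_{p_1p_2q}}\}$ is an F.S.U. of $K_1$, and $Q_{K_1}=2$. 2. If $x\pm1$ or $p_1(x\pm1)$ is a square and $a\pm1$ is not a square, then $\{\epsilon_{p_1},\epsilon_{p_2q},\epsilon_{p_1p_2q}\}$ is an F.S.U. of $K_1^+$, $\{\epsilon_{p_1},\epsilon_{p_2q},\sqrt{i\epsilon_{p_1p_2q}}\}$ is an F.S.U. of $K_1$, and $Q_{K_1}=2$. 3. If $a\pm1$ and $2p_1(x\pm1)$ are squares, then $\{\epsilon_{p_1},\epsilon_{p_2q},\sqrt{\epsilon_{p_1p_2q}}\}$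 is an F.S.U. of $K_1^+$, $\{\epsilon_{p_1},\sqrt{i\epsilon_{p_2q}},\sqrt{\epsilon_{p_1p_2q}}\}$ is an F.S.U. of $K_1$, and $Q_{K_1}=2$. 4. If $2p_1(x\pm1)$ is a square and $a\pm1$ is not a square, then $\{\epsilon_{p_1},\epsilon_{p_2q},\sqrt{\epsilon_{p_1p_2q}}\}$ is an F.S.U. of both $K_1^+$ and $K_1$, and $Q_{K_1}=1$. 5. If (i) $a\pm1$ is a square and ($p_2(x\pm1)$ or $2p_2(x\pm1)$ is a square), or (ii) $a\pm1$ is a square and ($q(x\pm1)$ or $2q(x\pm1)$ is a square), then $\{\epsilon_{p_1},\epsilon_{p_2q},\epsilon_{p_1p_2q}\}$ is an F.S.U. of $K_1^+$, $\{\epsilon_{p_1},\sqrt{i\epsilon_{p_2q}},\epsilon_{p_1p_2q}\}$ is an F.S.U. of $K_1$, and $Q_{K_1}=2$. 6. If (i) $p_2(a\pm1)$ is a square and ($p_2(x\pm1)$ or $q(x\pm1)$ is a square), or (ii) $2p_2(a\pm1)$ is a square and ($2p_2(x\pm1)$ or $2q(x\pm1)$ is a square), then $\{\epsilon_{p_1},\epsilon_{p_2q},\sqrt{\epsilon_{p_2q}\epsilon_{p_1p_2q}}\}$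 is an F.S.U. of both $K_1^+$ and $K_1$, and $Q_{K_1}=1$. 7. If (i) $p_2(a\pm1)$ is a square and ($2p_2(x\pm1)$ or $2q(x\pm1)$ is a square), or (ii) $2p_2(a\pm1)$ is a square and ($p_2(x\pm1)$ or $q(x\pm1)$ is a square), then $\{\epsilon_{p_1},\epsilon_{p_2q},\epsilon_{p_1p_2q}\}$ is an F.S.U. of $K_1^+$, $\{\epsilon_{p_1},\epsilon_{p_2q},\sqrt{i\epsilon_{p_2q}\epsilon_{p_1p_2q}}\}$ is an F.S.U. of $K_1$, and $Q_{K_1}=2$. -/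

import Mathlib

open NumberField

noncomputable section

/-- The family `u` of units of `K` is a fundamental system of units: every unit is, in exactly one
way, a root of unity of `K` times a product of integral powers of the members of `u`. -/
def IsFundamentalSystem (K : Type*) [Field K] {ι : Type*} [Fintype ι] (u : ι → (𝓞 K)ˣ) : Prop :=
  ∀ x : (𝓞 K)ˣ, ∃! ζe : Units.torsion K × (ι → ℤ), x = ζe.1 * ∏ i, u i ^ ζe.2 i

/-- The complex numbers `v i` all lie in the field `K ⊆ ℂ`, are units of its ring of integers, and
form a fundamental system of units of `K`. -/
def IsFSU (K : IntermediateField ℚ ℂ) {ι : Type*} [Fintype ι] (v : ι → ℂ) : Prop :=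
  ∃ u : ι → (𝓞 K)ˣ, (∀ i, (((u i : 𝓞 K) : K) : ℂ) = v i) ∧ IsFundamentalSystem K u

/-- The field `ℚ(√m)` inside `ℂ`. -/
def quadraticField (m : ℕ) : IntermediateField ℚ ℂ :=
  IntermediateField.adjoin ℚ {((√(m : ℝ) : ℝ) : ℂ)}

/-- `ε` is the fundamental unit `> 1` of the real quadratic field `ℚ(√m)`. -/
def IsFundamentalUnit (m : ℕ) (ε : ℝ) : Prop :=
  1 < ε ∧ IsFSU (quadraticField m) ![(ε : ℂ)]

/-- The field `ℚ(√m, √n)` inside `ℂ`. -/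
def biquadraticField (m n : ℕ) : IntermediateField ℚ ℂ :=
  IntermediateField.adjoin ℚ {((√(m : ℝ) : ℝ) : ℂ), ((√(n : ℝ) : ℝ) : ℂ)}

/-- The field `ℚ(√d, i)` inside `ℂ`. -/
def gaussianQuadraticField (d : ℕ) : IntermediateField ℚ ℂ :=
  IntermediateField.adjoin ℚ {((√(d : ℝ) : ℝ) : ℂ), Complex.I}

/-- The field `k(√p₁)` inside `ℂ`, where `k = ℚ(√(p₁p₂q), i)`. -/
def fieldK1 (p₁ p₂ q : ℕ) : IntermediateField ℚ ℂ :=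
  gaussianQuadraticField (p₁ * p₂ * q) ⊔ quadraticField p₁

/-- The rational number `r` is the square of a natural number. -/
def IsNatSq (r : ℚ) : Prop := ∃ n : ℕ, r = (n : ℚ) ^ 2

/-- `c (x ± 1)` is a square in `ℕ`, that is, `c (x + 1)` or `c (x - 1)` is. -/
def PMSq (c : ℕ) (x : ℚ) : Prop := IsNatSq (c * (x + 1)) ∨ IsNatSq (c * (x - 1))

end

/-! ### Units of subfields of ℂ and a criterion for fundamental systems. -/

open ComplexConjugate

/-! Write F for K₁⁺ and E₁, E₂, E₃ for the fundamental units of ℚ(√p₁), ℚ(√(p₂q)), ℚ(√(p₁p₂q)).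
Everything is read off from the classes of E₂ and E₃ in Fˣ modulo squares.

Suppose w² = kv with w in F, v a unit and k a nonzero rational. The relative norms of w to the three
quadratic subfields, divided by k, are units there, and v = w²/k is expressed through them; so v is,
up to sign, a product of powers of the Eⱼ (`exists_eq_prod_quadratic_units`). If k > 0, then v is
totally positive. As E₁ has norm -1 and E₂, E₃ have norm 1, the sign is then + and E₁ occurs to an
even power. Hence v is a square times one of 1, E₂, E₃, E₂E₃, and k times the same factor is a
square in F (`IsUnitTriple.eq_sq_mul`). For k = 1 and v = u² this shows which square roots must be
added to the Eⱼ to obtain all units of F; for k = 2 it decides whether 2v can be a square for some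
unit v.

The second question governs K₁ = F(i). For a unit u of K₁, u/ū is a root of unity. Since √2 is not
in F, K₁ contains no primitive 8th root of unity, so u/ū is 1 or i up to squares of roots of unity;
up to a root of unity, u therefore lies in F or satisfies u = iū (`unit_dichotomy`). In the latter
case (1 - i)u lies in F and has square 2uū. Conversely, if 2t is a square in F for a positive unit
t, then √(it) = ±(1 + i)/2 · √(2t) lies in K₁, and it generates the units of K₁ over W·E_F. So the
index is 2 exactly when 2 times some unit is a square in F.

As for the classes: if ε = r + s√d has norm 1, then 2(r ± 1)ε = (r ± 1 + s√d)², so c(r ± 1) being a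
square puts ε in the class of 2c. In F, p₁ is a square and q has the class of p₂, while 2, p₂, 2p₂
are nonsquares by Kummer theory. If neither a + 1 nor a - 1 is a square, factoring 2(a + 1) leaves
only the classes p₂ and 2p₂ for E₂. Each of the seven cases is then a computation in the group of
order four generated by 2 and p₂. -/

/-- The complex number `z` is a unit of the ring of integers of the field `F ⊆ ℂ`. -/
def IsUnitOf (F : IntermediateField ℚ ℂ) (z : ℂ) : Prop :=
  z ∈ F ∧ z ≠ 0 ∧ IsIntegral ℤ z ∧ IsIntegral ℤ z⁻¹

namespace IsUnitOf

variable {F G : IntermediateField ℚ ℂ} {z w : ℂ}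

lemma ne_zero (h : IsUnitOf F z) : z ≠ 0 := h.2.1

lemma mono (hFG : F ≤ G) (h : IsUnitOf F z) : IsUnitOf G z := ⟨hFG h.1, h.2⟩

lemma of_mem (h : IsUnitOf F z) (hz : z ∈ G) : IsUnitOf G z := ⟨hz, h.2⟩

lemma mul (hz : IsUnitOf F z) (hw : IsUnitOf F w) : IsUnitOf F (z * w) :=
  ⟨mul_mem hz.1 hw.1, mul_ne_zero hz.2.1 hw.2.1, hz.2.2.1.mul hw.2.2.1, by
    rw [mul_inv]; exact hz.2.2.2.mul hw.2.2.2⟩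

lemma inv (hz : IsUnitOf F z) : IsUnitOf F z⁻¹ :=
  ⟨inv_mem hz.1, inv_ne_zero hz.2.1, hz.2.2.2, by rw [inv_inv]; exact hz.2.2.1⟩

lemma div (hz : IsUnitOf F z) (hw : IsUnitOf F w) : IsUnitOf F (z / w) := by
  rw [div_eq_mul_inv]; exact hz.mul hw.inv

lemma map_conj (hz : IsUnitOf F z) (hF : starRingEnd ℂ z ∈ F) : IsUnitOf F (starRingEnd ℂ z) := by
  refine ⟨hF, by simpa using hz.2.1, ?_, ?_⟩
  · exact hz.2.2.1.map (starRingEnd ℂ).toIntAlgHom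
  · rw [← map_inv₀]
    exact hz.2.2.2.map (starRingEnd ℂ).toIntAlgHom

lemma of_sq (hz : z ∈ F) (h : IsUnitOf F (z ^ 2)) : IsUnitOf F z :=
  ⟨hz, fun h0 ↦ h.2.1 (by simp [h0]), .of_pow two_pos h.2.2.1,
    .of_pow two_pos (by rw [inv_pow]; exact h.2.2.2)⟩

lemma of_pow_eq_one (hz : z ∈ F) {n : ℕ} (hn : 0 < n) (h : z ^ n = 1) : IsUnitOf F z :=
  ⟨hz, fun h0 ↦ by simp [h0, hn.ne'] at h, .of_pow hn (by rw [h]; exact isIntegral_one),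
    .of_pow hn (by rw [inv_pow, h, inv_one]; exact isIntegral_one)⟩

lemma of_units (u : (𝓞 F)ˣ) : IsUnitOf F (((u : 𝓞 F) : F) : ℂ) := by
  have h : (((u⁻¹ : (𝓞 F)ˣ) : 𝓞 F) : F) = (((u : 𝓞 F) : F))⁻¹ := by simp
  refine ⟨((u : 𝓞 F) : F).2, by simp, ?_, ?_⟩
  · exact (RingOfIntegers.isIntegral_coe (u : 𝓞 F)).map (F.val.restrictScalars ℤ)
  · have := (RingOfIntegers.isIntegral_coe ((u⁻¹ : (𝓞 F)ˣ) : 𝓞 F)).map (F.val.restrictScalars ℤ)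
    have h' : (F.val.restrictScalars ℤ) (((u⁻¹ : (𝓞 F)ˣ) : 𝓞 F) : F) = (((u : 𝓞 F) : F) : ℂ)⁻¹ :=
      congrArg (Subtype.val) h
    rwa [h'] at this

lemma exists_units (h : IsUnitOf F z) : ∃ u : (𝓞 F)ˣ, (((u : 𝓞 F) : F) : ℂ) = z := by
  have hinj : Function.Injective (F.val.restrictScalars ℤ) := F.val.injective
  have h1 : IsIntegral ℤ (⟨z, h.1⟩ : F) :=
    (isIntegral_algHom_iff (F.val.restrictScalars ℤ) hinj).1 h.2.2.1
  have h2 : IsIntegral ℤ (⟨z⁻¹, inv_mem h.1⟩ : F) :=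
    (isIntegral_algHom_iff (F.val.restrictScalars ℤ) hinj).1 h.2.2.2
  refine ⟨⟨⟨_, h1⟩, ⟨_, h2⟩, ?_, ?_⟩, rfl⟩
  · apply RingOfIntegers.ext; apply Subtype.ext
    exact mul_inv_cancel₀ h.2.1
  · apply RingOfIntegers.ext; apply Subtype.ext
    exact inv_mul_cancel₀ h.2.1

end IsUnitOf

lemma units_coe_injective {F : IntermediateField ℚ ℂ} {u v : (𝓞 F)ˣ}
    (h : (((u : 𝓞 F) : F) : ℂ) = (((v : 𝓞 F) : F) : ℂ)) : u = v :=
  Units.ext (RingOfIntegers.ext (Subtype.ext h))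

/-- Embedding of the units of `F` into `ℂ`, as a homomorphism. -/
noncomputable def unitsToComplex (F : IntermediateField ℚ ℂ) : (𝓞 F)ˣ →* ℂˣ :=
  Units.map ((algebraMap F ℂ).comp (algebraMap (𝓞 F) F)).toMonoidHom

lemma unitsToComplex_apply {F : IntermediateField ℚ ℂ} (u : (𝓞 F)ˣ) :
    (unitsToComplex F u : ℂ) = (((u : 𝓞 F) : F) : ℂ) := rfl

lemma coe_prod_zpow {F : IntermediateField ℚ ℂ} {ι : Type*} [Fintype ι] (u : ι → (𝓞 F)ˣ)
    (k : ι → ℤ) : ((((∏ i, u i ^ k i : (𝓞 F)ˣ) : 𝓞 F) : F) : ℂ) =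
      ∏ i, (((u i : 𝓞 F) : F) : ℂ) ^ k i := by
  rw [← unitsToComplex_apply, map_prod, Units.coe_prod]
  simp [map_zpow, unitsToComplex_apply]

lemma coe_units_mul {F : IntermediateField ℚ ℂ} (u v : (𝓞 F)ˣ) :
    ((((u * v : (𝓞 F)ˣ) : 𝓞 F) : F) : ℂ) =
      (((u : 𝓞 F) : F) : ℂ) * (((v : 𝓞 F) : F) : ℂ) := rfl

lemma coe_units_pow {F : IntermediateField ℚ ℂ} (u : (𝓞 F)ˣ) (n : ℕ) :
    ((((u ^ n : (𝓞 F)ˣ) : 𝓞 F) : F) : ℂ) = (((u : 𝓞 F) : F) : ℂ) ^ n := rfl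

lemma torsion_pow_eq_one {F : IntermediateField ℚ ℂ} (ζ : Units.torsion F) :
    ∃ n : ℕ, 0 < n ∧ ((((ζ : (𝓞 F)ˣ) : 𝓞 F) : F) : ℂ) ^ n = 1 := by
  obtain ⟨n, hn, h⟩ := isOfFinOrder_iff_pow_eq_one.1 ((CommGroup.mem_torsion _).1 ζ.2)
  exact ⟨n, hn, by rw [← coe_units_pow, h]; rfl⟩

lemma mem_torsion_of_pow_eq_one {F : IntermediateField ℚ ℂ} (u : (𝓞 F)ˣ) {n : ℕ} (hn : 0 < n)
    (h : (((u : 𝓞 F) : F) : ℂ) ^ n = 1) : u ∈ Units.torsion F := by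
  refine (CommGroup.mem_torsion _).2 (isOfFinOrder_iff_pow_eq_one.2 ⟨n, hn, ?_⟩)
  exact units_coe_injective (by rw [coe_units_pow, h]; rfl)

lemma prod_zpow_isUnitOf {F : IntermediateField ℚ ℂ} {ι : Type*} [Fintype ι] {v : ι → ℂ}
    (hv : ∀ i, IsUnitOf F (v i)) (k : ι → ℤ) : IsUnitOf F (∏ i, v i ^ k i) := by
  choose u hu using fun i ↦ (hv i).exists_units
  simp_rw [← hu, ← coe_prod_zpow]
  exact IsUnitOf.of_units _

/-- A family of units that generates the units up to roots of unity and whose absolute values are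
multiplicatively independent is a fundamental system. -/
theorem isFSU_of_generates {F : IntermediateField ℚ ℂ} {ι : Type*} [Fintype ι] {v : ι → ℂ}
    (hv : ∀ i, IsUnitOf F (v i))
    (hgen : ∀ z, IsUnitOf F z → ∃ (n : ℕ) (ζ : ℂ) (k : ι → ℤ), 0 < n ∧ ζ ^ n = 1 ∧
      z = ζ * ∏ i, v i ^ k i)
    (hind : ∀ k : ι → ℤ, ‖∏ i, v i ^ k i‖ = 1 → k = 0) : IsFSU F v := by
  choose u hu using fun i ↦ (hv i).exists_units
  refine ⟨u, hu, fun x ↦ ?_⟩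
  obtain ⟨n, ζ, k, hn, hζ, hx⟩ := hgen _ (IsUnitOf.of_units x)
  have hprod (k : ι → ℤ) : ((((∏ i, u i ^ k i : (𝓞 F)ˣ) : 𝓞 F) : F) : ℂ) = ∏ i, v i ^ k i := by
    rw [coe_prod_zpow]; simp_rw [hu]
  have hk := prod_zpow_isUnitOf hv k
  have hζF : IsUnitOf F ζ := by
    have : ζ = (((x : 𝓞 F) : F) : ℂ) / ∏ i, v i ^ k i := by rw [hx]; field_simp [hk.ne_zero]
    rw [this]
    exact (IsUnitOf.of_units x).div hk
  obtain ⟨t, ht⟩ := hζF.exists_units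
  refine ⟨(⟨t, mem_torsion_of_pow_eq_one t hn (by rw [ht, hζ])⟩, k), ?_, ?_⟩
  · apply units_coe_injective
    rw [coe_units_mul, hprod, hx]
    exact congrArg (· * _) ht.symm
  · rintro ⟨t', k'⟩ h'
    have h1 : (t' : (𝓞 F)ˣ) * ∏ i, u i ^ k' i = t * ∏ i, u i ^ k i := by
      rw [← show x = _ from h']
      apply units_coe_injective
      rw [coe_units_mul, hprod, ht, hx]
    -- The quotient of two representations of the same unit is a root of unity, hence of absolute
    -- value 1.
    have h2 : k' - k = 0 := by
      apply hind
      rw [← hprod]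
      have h3 : ∏ i, u i ^ (k' - k) i = t * (t' : (𝓞 F)ˣ)⁻¹ := by
        simp only [Pi.sub_apply, zpow_sub, Finset.prod_mul_distrib, Finset.prod_inv_distrib]
        rw [mul_inv_eq_iff_eq_mul, mul_right_comm, ← h1, mul_right_comm, mul_inv_cancel, one_mul]
      have h4 : ∏ i, u i ^ (k' - k) i ∈ Units.torsion F := by
        rw [h3]
        exact mul_mem (mem_torsion_of_pow_eq_one t hn (by rw [ht, hζ])) (inv_mem t'.2)
      obtain ⟨m, hm, h5⟩ := torsion_pow_eq_one ⟨_, h4⟩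
      exact Complex.norm_eq_one_of_pow_eq_one h5 hm.ne'
    have h3 : k' = k := sub_eq_zero.1 h2
    subst h3
    have h4 : (t' : (𝓞 F)ˣ) = t := mul_right_cancel h1
    exact Prod.ext (Subtype.ext h4) rfl

theorem IsFSU.isUnitOf {F : IntermediateField ℚ ℂ} {ι : Type*} [Fintype ι] {v : ι → ℂ}
    (h : IsFSU F v) (i : ι) : IsUnitOf F (v i) := by
  obtain ⟨u, hu, -⟩ := h
  rw [← hu]
  exact .of_units _

theorem IsFSU.generates {F : IntermediateField ℚ ℂ} {ι : Type*} [Fintype ι] {v : ι → ℂ}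
    (h : IsFSU F v) {z : ℂ} (hz : IsUnitOf F z) : ∃ (n : ℕ) (ζ : ℂ) (k : ι → ℤ), 0 < n ∧ ζ ^ n = 1 ∧
      z = ζ * ∏ i, v i ^ k i := by
  obtain ⟨u, hu, hF⟩ := h
  obtain ⟨x, rfl⟩ := hz.exists_units
  obtain ⟨⟨ζ, k⟩, hx, -⟩ := hF x
  obtain ⟨n, hn, h1⟩ := torsion_pow_eq_one ζ
  refine ⟨n, _, k, hn, h1, ?_⟩
  conv_lhs => rw [show x = _ from hx]
  rw [coe_units_mul, coe_prod_zpow]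
  simp_rw [hu]

lemma eq_one_or_neg_one_of_real_of_pow_eq_one {ζ : ℂ} {n : ℕ} (hn : 0 < n) (h : ζ ^ n = 1)
    (hr : starRingEnd ℂ ζ = ζ) : ζ = 1 ∨ ζ = -1 := by
  obtain ⟨r, rfl⟩ := Complex.conj_eq_iff_real.1 hr
  have h1 : |r| = 1 := by
    have := Complex.norm_eq_one_of_pow_eq_one h hn.ne'
    simpa using this
  rcases eq_or_eq_neg_of_abs_eq h1 with h | h <;> simp [h]

/-! ### Arithmetic of rational numbers -/

lemma Rat.even_padicValRat_of_isSquare {r : ℚ} (ℓ : ℕ) [Fact ℓ.Prime] (hr : IsSquare r) :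
    Even (padicValRat ℓ r) := by
  obtain ⟨s, rfl⟩ := hr
  by_cases hs : s = 0
  · simp [hs]
  · exact ⟨_, padicValRat.mul hs hs⟩

/-- The ℓ-adic valuation is exactly 1, hence odd. -/
lemma Nat.not_isSquare_cast_of_dvd {ℓ n : ℕ} (hℓ : ℓ.Prime) (hn : ¬ ℓ ∣ n) :
    ¬ IsSquare ((ℓ * n : ℕ) : ℚ) := by
  have := Fact.mk hℓ
  intro h
  have h1 := Rat.even_padicValRat_of_isSquare ℓ h
  have hn0 : n ≠ 0 := by rintro rfl; simp at hn
  rw [padicValRat.of_nat, padicValNat.mul hℓ.ne_zero hn0, padicValNat_self,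
    padicValNat.eq_zero_of_not_dvd hn] at h1
  norm_num at h1

/-- The square of the denominator of s is prime to its numerator, so it would divide the squarefree
c. -/
lemma Rat.exists_int_of_natCast_mul_sq {c : ℕ} (hc : Squarefree c) {s : ℚ} {z : ℤ}
    (h : c * s ^ 2 = z) : ∃ t : ℤ, s = t := by
  have hs : s.den = 1 := by
    have h2 : (c : ℤ) * s.num ^ 2 = z * (s.den : ℤ) ^ 2 := by
      have hd : (s.den : ℚ) ≠ 0 := by exact_mod_cast s.den_ne_zero
      have : (c : ℚ) * s.num ^ 2 = z * (s.den : ℚ) ^ 2 := by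
        rw [← h]
        nth_rw 2 [← Rat.num_div_den s]
        field_simp
      exact_mod_cast this
    have h3 : ((s.den : ℤ)) ^ 2 ∣ (c : ℤ) * s.num ^ 2 := ⟨z, by rw [h2]; ring⟩
    have h4 : IsCoprime ((s.den : ℤ) ^ 2) (s.num ^ 2) := by
      apply IsCoprime.pow
      rw [Int.isCoprime_iff_gcd_eq_one, Int.gcd_comm]
      exact s.reduced
    have h5 : ((s.den : ℤ)) ^ 2 ∣ (c : ℤ) := h4.dvd_of_dvd_mul_right h3
    have h6 : s.den * s.den ∣ c := by
      rw [← sq]; exact_mod_cast h5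
    exact Nat.isUnit_iff.1 (hc _ h6)
  exact ⟨s.num, (Rat.den_eq_one_iff s).1 hs |>.symm⟩

/-- If `N (N - 4) = d B²` then `N` is a square up to a divisor of `2d`. -/
lemma exists_dvd_mul_sq_of_mul_sub_four {N d : ℕ} {B : ℚ} (hN : N ≠ 0)
    (hB : B ≠ 0) (h : (N : ℚ) * (N - 4) = d * B ^ 2) :
    ∃ c k : ℕ, c ∣ 2 * d ∧ k ≠ 0 ∧ N = c * k ^ 2 := by
  obtain ⟨c, k, hk, hc⟩ := Nat.sq_mul_squarefree N
  have hc0 : c ≠ 0 := hc.ne_zero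
  have hk0 : k ≠ 0 := by rintro rfl; simp at hk; exact hN hk.symm
  by_cases hd0 : d = 0
  · exact ⟨c, k, by simp [hd0], hk0, by rw [← hk]; ring⟩
  refine ⟨c, k, ?_, hk0, by rw [← hk]; ring⟩
  rw [← Nat.prod_primeFactors_of_squarefree hc]
  -- The squarefree part c of N is the product of its primes ℓ. If ℓ ∤ 2d, then ℓ ∤ N - 4, so the
  -- left side of the equation has odd ℓ-adic valuation and the right side an even one.
  refine (Finset.prod_dvd_prod_of_subset _ _ _ ?_).trans (Nat.prod_primeFactors_dvd (2 * d))
  intro ℓ hℓ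
  have hℓp := Nat.prime_of_mem_primeFactors hℓ
  have hℓc := Nat.dvd_of_mem_primeFactors hℓ
  have := Fact.mk hℓp
  rw [Nat.mem_primeFactors_of_ne_zero (by simp [hd0])]
  refine ⟨hℓp, ?_⟩
  by_contra hℓd
  have hℓ2 : ¬ ℓ ∣ 2 := fun h ↦ hℓd (h.mul_right d)
  have hℓd' : ¬ ℓ ∣ d := fun h ↦ hℓd (h.mul_left 2)
  obtain ⟨c', rfl⟩ := hℓc
  have hℓc' : ¬ ℓ ∣ c' := by
    rintro ⟨c'', rfl⟩
    exact hℓp.one_lt.ne' (Nat.isUnit_iff.1 (hc ℓ ⟨c'', by ring⟩))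
  have hc'0 : c' ≠ 0 := by rintro rfl; simp at hℓc'
  have hN4 : ((N : ℤ) - 4 : ℤ) ≠ 0 := by
    intro h0
    have : (N : ℚ) - 4 = 0 := by exact_mod_cast h0
    rw [this, mul_zero] at h
    have hd : (d : ℚ) ≠ 0 := by exact_mod_cast hd0
    exact (mul_ne_zero hd (pow_ne_zero 2 hB)) h.symm
  have hv := congrArg (padicValRat ℓ) h
  have hNcast : (N : ℚ) - 4 = (((N : ℤ) - 4 : ℤ) : ℚ) := by push_cast; ring
  have hnd : ¬ (ℓ : ℤ) ∣ (N : ℤ) - 4 := by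
    intro hdvd
    have h1 : (ℓ : ℤ) ∣ (N : ℤ) := by
      rw [← hk]; push_cast; exact ⟨k ^ 2 * c', by ring⟩
    have h2 : (ℓ : ℤ) ∣ 4 := by
      have := dvd_sub h1 hdvd
      simpa using this
    have h3 : ℓ ∣ 2 * 2 := by exact_mod_cast h2
    exact hℓ2 ((hℓp.dvd_mul.1 h3).elim id id)
  rw [padicValRat.mul (by exact_mod_cast hN) (by rw [hNcast]; exact_mod_cast hN4),
    padicValRat.mul (by exact_mod_cast hd0) (pow_ne_zero 2 hB), padicValRat.pow, hNcast,
    padicValRat.of_int, padicValInt.eq_zero_of_not_dvd hnd, padicValRat.of_nat, padicValRat.of_nat,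
    padicValNat.eq_zero_of_not_dvd hℓd', ← hk,
    padicValNat.mul (pow_ne_zero 2 hk0) (mul_ne_zero hℓp.ne_zero hc'0),
    padicValNat.pow, padicValNat.mul hℓp.ne_zero hc'0, padicValNat_self,
    padicValNat.eq_zero_of_not_dvd hℓc'] at hv
  push_cast at hv
  omega

/-- Only the trace 2r of a quadratic unit is known to be integral; writing r = s², integrality of
2s² already forces s to be an integer, as 2 is squarefree. -/
lemma isNatSq_of_isSquare {r : ℚ} {T : ℤ} (hT : 2 * r = T) (hr : IsSquare r) : IsNatSq r := by
  obtain ⟨s, rfl⟩ := hr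
  obtain ⟨t, rfl⟩ := Rat.exists_int_of_natCast_mul_sq (c := 2) Nat.prime_two.squarefree
    (s := s) (z := T) (by rw [← hT]; push_cast; ring)
  exact ⟨t.natAbs, by rw [← sq]; simp [Nat.cast_natAbs]⟩

/-- Modulo 4 the form is a² - b², which only takes the values 0, 1 and -1. -/
lemma sq_sub_mul_sq_ne_two {p : ℕ} (hp : p % 4 = 1) {a b : ℤ} :
    a ^ 2 - p * b ^ 2 ≠ 2 ∧ a ^ 2 - p * b ^ 2 ≠ -2 := by
  have hp' : (p : ZMod 4) = 1 := by
    rw [← ZMod.natCast_mod p 4, hp]; rfl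
  have key : ∀ x y : ZMod 4, x ^ 2 - 1 * y ^ 2 ≠ 2 ∧ x ^ 2 - 1 * y ^ 2 ≠ -2 := by decide
  constructor <;> intro h <;> have h := congrArg (Int.cast : ℤ → ZMod 4) h <;>
    push_cast [hp'] at h
  · exact (key _ _).1 h
  · exact (key _ _).2 h

/-- Otherwise -4, hence -1, would be a square modulo a prime congruent to 3 modulo 4. -/
lemma not_dvd_sq_add_four {q : ℕ} (hq : q.Prime) (hq4 : q % 4 = 3) (T : ℤ) :
    ¬ (q : ℤ) ∣ T ^ 2 + 4 := by
  have := Fact.mk hq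
  intro h
  have h1 : (T : ZMod q) ^ 2 = - 2 ^ 2 := by
    have := (ZMod.intCast_zmod_eq_zero_iff_dvd (T ^ 2 + 4) q).2 h
    push_cast at this
    linear_combination this
  have h2 : (2 : ZMod q) ≠ 0 := by
    intro h0
    have : ((2 : ℕ) : ZMod q) = 0 := by exact_mod_cast h0
    have := (Nat.prime_dvd_prime_iff_eq hq Nat.prime_two).1 ((ZMod.natCast_eq_zero_iff 2 q).1 this)
    omega
  exact ZMod.mod_four_ne_three_of_sq_eq_neg_sq' h2 h1 hq4

/-- `-1` is not a norm from `ℚ(√d)` of a number of integral trace if a prime `≡ 3 mod 4` divides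
`d` exactly once. -/
lemma sq_sub_mul_sq_ne_neg_one {q d : ℕ} (hq : q.Prime) (hq4 : q % 4 = 3) (hqd : ¬ q ∣ d)
    {r s : ℚ} {T : ℤ} (hT : 2 * r = T) : r ^ 2 - (d * q : ℕ) * s ^ 2 ≠ -1 := by
  have := Fact.mk hq
  intro h
  have hd0 : d ≠ 0 := by rintro rfl; simp at hqd
  -- Clearing denominators leaves on the left an integer prime to q, and on the right a number of
  -- odd q-adic valuation.
  have h1 : ((T ^ 2 + 4 : ℤ) : ℚ) = (d * q : ℕ) * (2 * s) ^ 2 := by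
    push_cast at h ⊢
    rw [← hT]; linear_combination 4 * h
  have hT0 : (T ^ 2 + 4 : ℤ) ≠ 0 := by positivity
  have hs : (2 * s) ≠ 0 := by
    intro h0
    rw [h0] at h1
    have : ((T ^ 2 + 4 : ℤ) : ℚ) ≠ 0 := by exact_mod_cast hT0
    exact this (by rw [h1]; ring)
  have hv := congrArg (padicValRat q) h1
  rw [padicValRat.mul (by exact_mod_cast mul_ne_zero hd0 hq.ne_zero) (pow_ne_zero 2 hs),
    padicValRat.pow, padicValRat.of_int,
    padicValInt.eq_zero_of_not_dvd (not_dvd_sq_add_four hq hq4 T), padicValRat.of_nat,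
    padicValNat.mul hd0 hq.ne_zero, padicValNat_self, padicValNat.eq_zero_of_not_dvd hqd] at hv
  push_cast at hv
  omega

/-! ### Norm, trace and square class of a quadratic unit. -/

/-- A unit of the integral closure of `ℤ` in the field `L`. -/
def IsIntegralUnit {L : Type*} [Field L] (w : L) : Prop :=
  w ≠ 0 ∧ IsIntegral ℤ w ∧ IsIntegral ℤ w⁻¹

namespace IsIntegralUnit

variable {L M : Type*} [Field L] [Field M] {v w : L}

lemma map (h : IsIntegralUnit w) (φ : L →+* M) : IsIntegralUnit (φ w) :=
  ⟨(map_ne_zero φ).2 h.1, h.2.1.map φ.toIntAlgHom, by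
    rw [← map_inv₀]; exact h.2.2.map φ.toIntAlgHom⟩

lemma of_map (φ : L →+* M) (h : IsIntegralUnit (φ w)) : IsIntegralUnit w := by
  have hinj : Function.Injective φ.toIntAlgHom := φ.injective
  refine ⟨fun h0 ↦ h.1 (by simp [h0]), (isIntegral_algHom_iff φ.toIntAlgHom hinj).1 h.2.1,
    (isIntegral_algHom_iff φ.toIntAlgHom hinj).1 ?_⟩
  have : φ.toIntAlgHom w⁻¹ = (φ w)⁻¹ := map_inv₀ φ w
  rw [this]; exact h.2.2

lemma mul (hv : IsIntegralUnit v) (hw : IsIntegralUnit w) : IsIntegralUnit (v * w) :=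
  ⟨mul_ne_zero hv.1 hw.1, hv.2.1.mul hw.2.1, by rw [mul_inv]; exact hv.2.2.mul hw.2.2⟩

lemma of_sq (h : IsIntegralUnit (w ^ 2)) : IsIntegralUnit w :=
  ⟨fun h0 ↦ h.1 (by simp [h0]), .of_pow two_pos h.2.1,
    .of_pow two_pos (by rw [inv_pow]; exact h.2.2)⟩

end IsIntegralUnit

lemma Rat.exists_int_of_isIntegral_cast {L : Type*} [Field L] [CharZero L] {r : ℚ}
    (h : IsIntegral ℤ (r : L)) : ∃ T : ℤ, r = T := by
  have h1 : IsIntegral ℤ r := by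
    have hinj : Function.Injective (Rat.castHom L).toIntAlgHom := (Rat.castHom L).injective
    exact (isIntegral_algHom_iff (Rat.castHom L).toIntAlgHom hinj).1 h
  obtain ⟨T, hT⟩ := IsIntegrallyClosed.isIntegral_iff.1 h1
  exact ⟨T, by simpa using hT.symm⟩

/-- Norm and trace of a unit of a quadratic field, for the conjugation `φ`. -/
lemma norm_trace_of_isIntegralUnit {L : Type*} [Field L] [CharZero L] {g : L} {d : ℕ}
    (hg : g ^ 2 = d) (φ : L →+* L) (hφ : φ g = -g) {r s : ℚ}
    (h : IsIntegralUnit ((r : L) + s * g)) :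
    (r ^ 2 - d * s ^ 2 = 1 ∨ r ^ 2 - d * s ^ 2 = -1) ∧ ∃ T : ℤ, 2 * r = T := by
  have h1 := h.map φ
  have hφ' : φ ((r : L) + s * g) = r - s * g := by simp [hφ]; ring
  rw [hφ'] at h1
  constructor
  · have h2 := h.mul h1
    have h3 : ((r : L) + s * g) * (r - s * g) = ((r ^ 2 - d * s ^ 2 : ℚ) : L) := by
      push_cast; linear_combination (- (s : L) ^ 2) * hg
    rw [h3] at h2
    obtain ⟨A, hA⟩ := Rat.exists_int_of_isIntegral_cast h2.2.1
    obtain ⟨B, hB⟩ := Rat.exists_int_of_isIntegral_cast (L := L) (r := (r ^ 2 - d * s ^ 2)⁻¹)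
      (by rw [Rat.cast_inv]; exact h2.2.2)
    have hne : r ^ 2 - d * s ^ 2 ≠ 0 := by
      intro h0; apply h2.1; rw [h0, Rat.cast_zero]
    have hAB : A * B = 1 := by
      have : (A : ℚ) * B = 1 := by rw [← hA, ← hB, mul_inv_cancel₀ hne]
      exact_mod_cast this
    rw [hA]
    rcases Int.eq_one_or_neg_one_of_mul_eq_one hAB with h | h <;> simp [h]
  · have h2 := h.2.1.add h1.2.1
    have h3 : ((r : L) + s * g) + (r - s * g) = ((2 * r : ℚ) : L) := by push_cast; ring
    rw [h3] at h2
    exact Rat.exists_int_of_isIntegral_cast h2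

/-- The source of all square classes below: expand the right side and replace ds² by r² - 1. -/
lemma two_mul_add_one_mul_eq_sq {L : Type*} [Field L] [CharZero L] {g : L} {d : ℕ}
    (hg : g ^ 2 = d) {r s : ℚ} (h : r ^ 2 - d * s ^ 2 = 1) :
    2 * ((r : L) + 1) * (r + s * g) = (r + 1 + s * g) ^ 2 := by
  have h' : (r : L) ^ 2 - d * s ^ 2 = 1 := by exact_mod_cast congrArg (Rat.cast : ℚ → L) h
  linear_combination - (s : L) ^ 2 * hg + h'

lemma two_mul_sub_one_mul_eq_sq {L : Type*} [Field L] [CharZero L] {g : L} {d : ℕ}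
    (hg : g ^ 2 = d) {r s : ℚ} (h : r ^ 2 - d * s ^ 2 = 1) :
    2 * ((r : L) - 1) * (r + s * g) = (r - 1 + s * g) ^ 2 := by
  have h' : (r : L) ^ 2 - d * s ^ 2 = 1 := by exact_mod_cast congrArg (Rat.cast : ℚ → L) h
  linear_combination - (s : L) ^ 2 * hg + h'

/-- If `c (r ± 1)` is a square, then `2c` times the unit `r + s√d` of norm one is a square. -/
lemma exists_eq_two_mul_sq_of_pmSq {L : Type*} [Field L] [CharZero L] {g : L} {d : ℕ}
    (hg : g ^ 2 = d) {r s : ℚ} (h : r ^ 2 - d * s ^ 2 = 1) (hr : r ≠ 1) (hr' : r ≠ -1) {c : ℕ}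
    (hc : c ≠ 0) (hsq : PMSq c r) : ∃ w : L, (r : L) + s * g = 2 * c * w ^ 2 := by
  have hcL : (c : L) ≠ 0 := by exact_mod_cast hc
  rcases hsq with ⟨k, hk⟩ | ⟨k, hk⟩
  · have hk' : (c : L) * (r + 1) = k ^ 2 := by exact_mod_cast congrArg (Rat.cast : ℚ → L) hk
    have hk0 : (k : L) ≠ 0 := by
      intro h0
      rw [h0] at hk'
      have : (r : L) + 1 = 0 := by simpa [hcL] using hk'
      apply hr'
      have : ((r + 1 : ℚ) : L) = 0 := by push_cast; exact this
      have := Rat.cast_eq_zero.1 this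
      linarith
    -- Substitute r + 1 = k²/c in 2(r + 1)ε = (r + 1 + sg)² and solve for ε.
    refine ⟨(r + 1 + s * g) / (2 * k), ?_⟩
    rw [div_pow, ← two_mul_add_one_mul_eq_sq hg h]
    field_simp
    linear_combination -((r : L) + s * g) * hk'
  · have hk' : (c : L) * (r - 1) = k ^ 2 := by exact_mod_cast congrArg (Rat.cast : ℚ → L) hk
    have hk0 : (k : L) ≠ 0 := by
      intro h0
      rw [h0] at hk'
      have : (r : L) - 1 = 0 := by simpa [hcL] using hk'
      apply hr
      have : ((r - 1 : ℚ) : L) = 0 := by push_cast; exact this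
      have := Rat.cast_eq_zero.1 this
      linarith
    refine ⟨(r - 1 + s * g) / (2 * k), ?_⟩
    rw [div_pow, ← two_mul_sub_one_mul_eq_sq hg h]
    field_simp
    linear_combination -((r : L) + s * g) * hk'

/-! ### Fundamental units of real quadratic fields. -/

/-- `ε = r + s g`, with `g² = d`, generates the units of `ℚ(g)` up to sign, and is greater than `1`
in the real embedding `ι`. -/
structure IsQuadFundUnit {L : Type*} [Field L] [CharZero L] (ι : L →+* ℝ) (φ : L →+* L) (d : ℕ)
    (g : L) (r s : ℚ) : Prop where
  sq_eq : g ^ 2 = d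
  conj_eq : φ g = -g
  one_lt : 1 < ι (r + s * g)
  isUnit : IsIntegralUnit ((r : L) + s * g)
  generates : ∀ r' s' : ℚ, IsIntegralUnit ((r' : L) + s' * g) →
    ∃ k : ℤ, (r' : L) + s' * g = (r + s * g) ^ k ∨ (r' : L) + s' * g = -(r + s * g) ^ k

namespace IsQuadFundUnit

variable {L : Type*} [Field L] [CharZero L] {ι : L →+* ℝ} {φ : L →+* L} {d : ℕ} {g : L} {r s : ℚ}

/-- A square root of ε in the quadratic field would be a unit ±ε^k, whence ε = ε^(2k) with ε > 1. -/
lemma not_sq (h : IsQuadFundUnit ι φ d g r s) (r' s' : ℚ) :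
    (r : L) + s * g ≠ (r' + s' * g) ^ 2 := by
  intro heq
  have hu : IsIntegralUnit ((r' : L) + s' * g) := .of_sq (by rw [← heq]; exact h.isUnit)
  obtain ⟨k, hk⟩ := h.generates r' s' hu
  have h1 : (r : L) + s * g = (r + s * g) ^ (2 * k) := by
    rw [mul_comm 2 k, zpow_mul]
    rcases hk with hk | hk
    · rw [← hk]; exact_mod_cast heq
    · rw [hk, neg_sq] at heq; exact_mod_cast heq
  have h2 := congrArg ι h1
  rw [map_zpow₀] at h2
  have h3 : (1 : ℤ) = 2 * k := by
    apply zpow_right_injective₀ (by linarith [h.one_lt]) h.one_lt.ne'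
    simpa using h2
  omega

lemma s_ne_zero (h : IsQuadFundUnit ι φ d g r s) : s ≠ 0 := by
  rintro rfl
  have hn := norm_trace_of_isIntegralUnit h.sq_eq φ h.conj_eq h.isUnit
  have h1 := h.one_lt
  simp only [Rat.cast_zero, zero_mul, add_zero, map_ratCast] at h1
  have h1 : 1 < r := by exact_mod_cast h1
  rcases hn.1 with h2 | h2 <;> nlinarith

/-- The conjugate is the inverse of a number greater than 1, hence positive, so the trace 2r is
positive; and r² = 1 + ds² > 1. -/
lemma one_lt_r (h : IsQuadFundUnit ι φ d g r s) (hn : r ^ 2 - d * s ^ 2 = 1) (hd : d ≠ 0) :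
    1 < r := by
  have hd' : 0 < (d : ℚ) := by positivity
  have hs := h.s_ne_zero
  have h1 : 1 < r ^ 2 := by
    have : 0 < d * s ^ 2 := by positivity
    linarith
  have h2 := h.one_lt
  by_contra hr
  have hr' : r < -1 := by nlinarith
  have hr'' : (r : ℝ) < -1 := by exact_mod_cast hr'
  have h3 : ι (r + s * g) * ι (r - s * g) = 1 := by
    rw [← map_mul, ← map_one ι]
    congr 1
    have h' : (r : L) ^ 2 - d * s ^ 2 = 1 := by exact_mod_cast congrArg (Rat.cast : ℚ → L) hn
    linear_combination - (s : L) ^ 2 * h.sq_eq + h'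
  have h4 : ι (r + s * g) + ι (r - s * g) = 2 * r := by
    rw [← map_add, show ((r : L) + s * g) + (r - s * g) = ((2 * r : ℚ) : L) by push_cast; ring,
      map_ratCast]
    push_cast; rfl
  have h5 : 0 < ι (r - s * g) := by
    by_contra h6
    nlinarith
  linarith

/-- The class modulo squares of a fundamental unit of norm one. -/
lemma exists_dvd (h : IsQuadFundUnit ι φ d g r s) (hn : r ^ 2 - d * s ^ 2 = 1) (hd : d ≠ 0) :
    ∃ c k : ℕ, c ∣ 2 * d ∧ k ≠ 0 ∧ 2 * (r + 1) = c * k ^ 2 ∧ c ≠ 1 ∧ c ≠ d := by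
  obtain ⟨T, hT⟩ := (norm_trace_of_isIntegralUnit h.sq_eq φ h.conj_eq h.isUnit).2
  have hr := h.one_lt_r hn hd
  have hT0 : 0 ≤ T + 2 := by
    have : (0 : ℚ) ≤ ((T + 2 : ℤ) : ℚ) := by push_cast; rw [← hT]; linarith
    exact_mod_cast this
  obtain ⟨N, hN⟩ := Int.eq_ofNat_of_zero_le hT0
  have hNr : (N : ℚ) = 2 * (r + 1) := by
    have : ((T + 2 : ℤ) : ℚ) = N := by rw [hN]; simp
    rw [← this]; push_cast; rw [← hT]; ring
  have hN0 : N ≠ 0 := by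
    rintro rfl
    simp at hNr
    linarith
  -- With N = 2(r + 1), a natural number by integrality of the trace, N - 4 is 2(r - 1) and the norm
  -- equation reads N(N - 4) = d(2s)².
  obtain ⟨c, k, hc, hk, hck⟩ := exists_dvd_mul_sq_of_mul_sub_four (N := N) (d := d) (B := 2 * s) hN0
    (mul_ne_zero two_ne_zero h.s_ne_zero) (by rw [hNr]; linear_combination 4 * hn)
  have hck' : 2 * (r + 1) = c * (k : ℚ) ^ 2 := by rw [← hNr, hck]; push_cast; rfl
  have hkL : (k : L) ≠ 0 := by exact_mod_cast hk
  have hdL : (d : L) ≠ 0 := by exact_mod_cast hd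
  have hckL : 2 * ((r : L) + 1) = c * (k : L) ^ 2 := by
    exact_mod_cast congrArg (Rat.cast : ℚ → L) hck'
  have hsq := two_mul_add_one_mul_eq_sq h.sq_eq hn
  rw [hckL] at hsq
  refine ⟨c, k, hc, hk, hck', ?_, ?_⟩
  · rintro rfl
    apply h.not_sq ((r + 1) / k) (s / k)
    push_cast
    field_simp
    push_cast at hsq
    linear_combination hsq
  -- As d = g² is a square in L, c = d also makes ε a square, namely of (r + 1 + sg)/(kg), rewritten
  -- in the basis 1, g.
  · rintro rfl
    apply h.not_sq (s / k) ((r + 1) / (k * c))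
    push_cast
    have hg := h.sq_eq
    field_simp
    have : (s * c + g * (r + 1) : L) ^ 2 = c * (r + 1 + s * g) ^ 2 := by
      linear_combination ((r + 1 : L) ^ 2 - c * s ^ 2) * hg
    rw [this, ← hsq]
    ring

end IsQuadFundUnit

/-! ### Biquadratic fields: rational squares, and units as products of quadratic units. -/

/-- A field `L = ℚ(e, f)` with `e² = m`, `f² = n`, two automorphisms changing the sign of exactly
one of `e`, `f`, and a real embedding. -/
structure BiquadraticData (L : Type*) [Field L] (m n : ℕ) where
  e : L
  f : L
  σ : L →+* L
  τ : L →+* L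
  ι : L →+* ℝ
  e_sq : e ^ 2 = m
  f_sq : f ^ 2 = n
  σ_e : σ e = -e
  σ_f : σ f = f
  τ_e : τ e = e
  τ_f : τ f = -f
  coords : ∀ w : L, ∃ r s t u : ℚ, w = r + s * e + t * f + u * (e * f)

namespace BiquadraticData

variable {L : Type*} [Field L] [CharZero L] {m n : ℕ}

/-- Kummer theory: if w² is rational, then σ and τ multiply w by signs, and the pair of signs
singles out one of the lines spanned by 1, e, f, ef. -/
lemma isSquare_ratCast (D : BiquadraticData L m n) {q : ℚ} (hq : IsSquare (q : L)) :
    IsSquare q ∨ IsSquare (q * m) ∨ IsSquare (q * n) ∨ IsSquare (q * (m * n : ℕ)) := by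
  obtain ⟨w, hw⟩ := hq
  obtain ⟨r, s, t, u, hc⟩ := D.coords w
  have hσ : D.σ w = r - s * D.e + t * D.f - u * (D.e * D.f) := by
    rw [hc]; simp [D.σ_e, D.σ_f]; ring
  have hτ : D.τ w = r + s * D.e - t * D.f - u * (D.e * D.f) := by
    rw [hc]; simp [D.τ_e, D.τ_f]; ring
  have he := D.e_sq
  have hf := D.f_sq
  have hσ2 : D.σ w = w ∨ D.σ w = -w := by
    apply mul_self_eq_mul_self_iff.1
    rw [← map_mul, ← hw, map_ratCast]
  have hτ2 : D.τ w = w ∨ D.τ w = -w := by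
    apply mul_self_eq_mul_self_iff.1
    rw [← map_mul, ← hw, map_ratCast]
  have key (k a : ℚ) (g : L) (hg : g ^ 2 = (k : L)) (hwg : w = a * g) :
      IsSquare (q * k) := by
    refine ⟨a * k, ?_⟩
    have : ((q * k : ℚ) : L) = ((a * k * (a * k) : ℚ) : L) := by
      push_cast; rw [hw, hwg, ← hg]; ring
    exact_mod_cast this
  have hστ : D.σ (D.τ w) = r - s * D.e - t * D.f + u * (D.e * D.f) := by
    rw [hτ]; simp [D.σ_e, D.σ_f]; ring
  rcases hσ2 with h1 | h1 <;> rcases hτ2 with h2 | h2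
  · have h3 : D.σ (D.τ w) = w := by rw [h2, h1]
    have : w = r := by
      linear_combination (1 / 4 : L) * (hc + hσ + hτ + hστ) - (1 / 4 : L) * (h1 + h2 + h3)
    left
    simpa using key 1 r 1 (by simp) (by simpa using this)
  · have h3 : D.σ (D.τ w) = -w := by rw [h2, map_neg, h1]
    have : w = t * D.f := by
      linear_combination (1 / 4 : L) * (hc + hσ - hτ - hστ) - (1 / 4 : L) * (h1 - h2 - h3)
    right; right; left
    exact key n t D.f (by simpa using hf) this
  · have h3 : D.σ (D.τ w) = -w := by rw [h2, h1]
    have : w = s * D.e := by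
      linear_combination (1 / 4 : L) * (hc - hσ + hτ - hστ) - (1 / 4 : L) * (-h1 + h2 - h3)
    right; left
    exact key m s D.e (by simpa using he) this
  · have h3 : D.σ (D.τ w) = w := by rw [h2, map_neg, h1, neg_neg]
    have : w = u * (D.e * D.f) := by
      linear_combination (1 / 4 : L) * (hc - hσ - hτ + hστ) - (1 / 4 : L) * (-h1 - h2 + h3)
    right; right; right
    exact key (m * n : ℕ) u (D.e * D.f) (by rw [mul_pow, he, hf]; push_cast; rfl) this

/-- These are the relative norms of w to the fixed fields of τ, σ and στ. -/
lemma mul_conj_mem (D : BiquadraticData L m n) (w : L) :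
    (∃ r s : ℚ, w * D.τ w = r + s * D.e) ∧ (∃ r s : ℚ, w * D.σ w = r + s * D.f) ∧
      (∃ r s : ℚ, w * D.σ (D.τ w) = r + s * (D.e * D.f)) ∧ D.σ (D.σ w) = w := by
  obtain ⟨r, s, t, u, hc⟩ := D.coords w
  have hσ : D.σ w = r - s * D.e + t * D.f - u * (D.e * D.f) := by
    rw [hc]; simp [D.σ_e, D.σ_f]; ring
  have hτ : D.τ w = r + s * D.e - t * D.f - u * (D.e * D.f) := by
    rw [hc]; simp [D.τ_e, D.τ_f]; ring
  have hστ : D.σ (D.τ w) = r - s * D.e - t * D.f + u * (D.e * D.f) := by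
    rw [hτ]; simp [D.σ_e, D.σ_f]; ring
  have he := D.e_sq
  have hf := D.f_sq
  refine ⟨⟨r ^ 2 + s ^ 2 * m - t ^ 2 * n - u ^ 2 * m * n, 2 * r * s - 2 * t * u * n, ?_⟩,
    ⟨r ^ 2 + t ^ 2 * n - s ^ 2 * m - u ^ 2 * m * n, 2 * r * t - 2 * s * u * m, ?_⟩,
    ⟨r ^ 2 + u ^ 2 * m * n - s ^ 2 * m - t ^ 2 * n, 2 * r * u - 2 * s * t, ?_⟩, ?_⟩
  · rw [hτ, hc]; push_cast; rw [← he, ← hf]; ring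
  · rw [hσ, hc]; push_cast; rw [← he, ← hf]; ring
  · rw [hστ, hc]; push_cast; rw [← he, ← hf]; ring
  · rw [hσ, hc]; simp [D.σ_e, D.σ_f]

/-- The three quadratic fundamental units of a biquadratic field. -/
structure HasFundUnits (D : BiquadraticData L m n) (r₁ s₁ r₂ s₂ r₃ s₃ : ℚ) : Prop where
  fst : IsQuadFundUnit D.ι D.σ m D.e r₁ s₁
  snd : IsQuadFundUnit D.ι D.τ n D.f r₂ s₂
  trd : IsQuadFundUnit D.ι D.σ (m * n) (D.e * D.f) r₃ s₃

/-- If `w² / k` is a unit, with `k` rational, then it is, up to sign, a product of powers of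
quadratic units. -/
theorem exists_eq_prod_quadratic_units {D : BiquadraticData L m n} {r₁ s₁ r₂ s₂ r₃ s₃ : ℚ}
    (H : D.HasFundUnits r₁ s₁ r₂ s₂ r₃ s₃) {w v : L} {k : ℚ} (hk : k ≠ 0) (hv : IsIntegralUnit v)
    (hw : w ^ 2 = k * v) : ∃ a b c : ℤ,
      v = (r₁ + s₁ * D.e) ^ a * (r₂ + s₂ * D.f) ^ b * (D.σ (r₃ + s₃ * (D.e * D.f))) ^ c ∨
      v = -((r₁ + s₁ * D.e) ^ a * (r₂ + s₂ * D.f) ^ b * (D.σ (r₃ + s₃ * (D.e * D.f))) ^ c) := by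
  have hkL : (k : L) ≠ 0 := by exact_mod_cast hk
  have hw0 : w ≠ 0 := by
    rintro rfl
    apply mul_ne_zero hkL hv.1
    rw [← hw]; ring
  obtain ⟨⟨x₁, y₁, h₁⟩, ⟨x₂, y₂, h₂⟩, ⟨x₃, y₃, h₃⟩, hσσ⟩ := D.mul_conj_mem w
  -- Neither w nor k need be a unit, but the square of w·φ(w)/k is v·φ(v).
  have unit (φ : L →+* L) : IsIntegralUnit (w * φ w / k) := by
    apply IsIntegralUnit.of_sq
    have : (w * φ w / k) ^ 2 = v * φ v := by
      have h := congrArg φ hw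
      rw [map_pow, map_mul, map_ratCast] at h
      rw [div_pow, mul_pow, hw, h]
      field_simp
    rw [this]
    exact hv.mul (hv.map φ)
  have h₁' : w * D.τ w / k = ((x₁ / k : ℚ) : L) + ((y₁ / k : ℚ) : L) * D.e := by
    rw [h₁]; push_cast; ring
  have h₂' : w * D.σ w / k = ((x₂ / k : ℚ) : L) + ((y₂ / k : ℚ) : L) * D.f := by
    rw [h₂]; push_cast; ring
  have h₃' : w * D.σ (D.τ w) / k = ((x₃ / k : ℚ) : L) + ((y₃ / k : ℚ) : L) * (D.e * D.f) := by
    rw [h₃]; push_cast; ring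
  obtain ⟨a, ha⟩ := H.fst.generates _ _ (by rw [← h₁']; exact unit D.τ)
  obtain ⟨b, hb⟩ := H.snd.generates _ _ (by rw [← h₂']; exact unit D.σ)
  obtain ⟨c, hc⟩ := H.trd.generates _ _ (by rw [← h₃']; exact unit (D.σ.comp D.τ))
  rw [← h₁'] at ha
  rw [← h₂'] at hb
  rw [← h₃'] at hc
  have hc' := hc.imp (congrArg D.σ) (congrArg D.σ)
  have hl : D.σ (w * D.σ (D.τ w) / k) = D.σ w * D.τ w / k := by
    rw [map_div₀, map_mul, (D.mul_conj_mem (D.τ w)).2.2.2, map_ratCast]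
  rw [hl, map_neg, map_zpow₀] at hc'
  have hσw : D.σ w ≠ 0 := (map_ne_zero _).2 hw0
  have hτw : D.τ w ≠ 0 := (map_ne_zero _).2 hw0
  -- The relation 2 = (1 + τ) + (1 + σ) - σ(1 + στ) in the group ring of the Galois group, applied
  -- to w.
  have hv' : v = (w * D.τ w / k) * (w * D.σ w / k) * (D.σ w * D.τ w / k)⁻¹ := by
    have : v = w ^ 2 / k := by rw [hw]; field_simp
    rw [this]; field_simp
  refine ⟨a, b, -c, ?_⟩
  rw [hv', zpow_neg]
  rcases ha with ha | ha <;> rcases hb with hb | hb <;> rcases hc' with hc' | hc' <;>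
    rw [ha, hb, hc'] <;> simp [inv_neg]

end BiquadraticData

/-! ### Norms and square classes of the fundamental units that occur. -/

lemma mul_conj_eq_ratCast {L : Type*} [Field L] [CharZero L] {g : L} {d : ℕ}
    (hg : g ^ 2 = d) (φ : L →+* L) (hφ : φ g = -g) (r s : ℚ) :
    ((r : L) + s * g) * φ (r + s * g) = ((r ^ 2 - d * s ^ 2 : ℚ) : L) := by
  have hφ' : φ ((r : L) + s * g) = r - s * g := by simp [hφ]; ring
  rw [hφ']
  push_cast
  linear_combination (- (s : L) ^ 2) * hg

namespace IsQuadFundUnit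

variable {L : Type*} [Field L] [CharZero L] {ι : L →+* ℝ} {φ : L →+* L} {d : ℕ} {g : L} {r s : ℚ}

/-- The fundamental unit of `ℚ(√p)`, for a prime `p ≡ 1 mod 4`, has norm `-1`. -/
lemma norm_eq_neg_one (h : IsQuadFundUnit ι φ d g r s) (hd : d.Prime) (hd4 : d % 4 = 1) :
    r ^ 2 - d * s ^ 2 = -1 := by
  refine (norm_trace_of_isIntegralUnit h.sq_eq φ h.conj_eq h.isUnit).1.resolve_left fun hn ↦ ?_
  obtain ⟨c, k, hc, hk, hck, hc1, hcd⟩ := h.exists_dvd hn hd.ne_zero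
  have hk' : (k : ℚ) ≠ 0 := by exact_mod_cast hk
  have hd' : (d : ℚ) ≠ 0 := by exact_mod_cast hd.ne_zero
  have hB : (2 * (r + 1)) * (2 * (r + 1) - 4) = d * (2 * s) ^ 2 := by linear_combination 4 * hn
  rw [hck] at hB
  obtain ⟨c₁, c₂, h₁, h₂, rfl⟩ := (Nat.dvd_mul).1 hc
  -- For prime d the divisors of 2d are 1, d, 2, 2d. The first two are excluded already; c = 2 gives
  -- d(s/k)² = k² - 2 and c = 2d gives (s/k)² = dk² - 2, both impossible modulo 4.
  rcases (Nat.dvd_prime Nat.prime_two).1 h₁ with rfl | rfl <;>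
    rcases (Nat.dvd_prime hd).1 h₂ with rfl | rfl
  · simp at hc1
  · simp at hcd
  · have hz : (d : ℚ) * (s / k) ^ 2 = ((k ^ 2 - 2 : ℤ) : ℚ) := by
      push_cast at hB ⊢
      field_simp
      linear_combination (-1 / 4 : ℚ) * hB
    obtain ⟨t, ht⟩ := Rat.exists_int_of_natCast_mul_sq hd.squarefree hz
    rw [ht] at hz
    have hz' : (d : ℤ) * t ^ 2 = k ^ 2 - 2 := by exact_mod_cast hz
    exact (sq_sub_mul_sq_ne_two hd4 (a := k) (b := t)).1 (by linarith)
  · have hz : ((1 : ℕ) : ℚ) * (s / k) ^ 2 = ((c₂ * k ^ 2 - 2 : ℤ) : ℚ) := by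
      push_cast at hB ⊢
      field_simp
      apply mul_left_cancel₀ hd'
      linear_combination (-1 / 4 : ℚ) * hB
    obtain ⟨t, ht⟩ := Rat.exists_int_of_natCast_mul_sq squarefree_one hz
    rw [ht] at hz
    have hz' : ((1 : ℕ) : ℤ) * t ^ 2 = c₂ * k ^ 2 - 2 := by exact_mod_cast hz
    exact (sq_sub_mul_sq_ne_two hd4 (a := t) (b := k)).2 (by push_cast at hz'; linarith)

/-- A fundamental unit has norm `1` if a prime `q ≡ 3 mod 4` divides the radicand. -/
lemma norm_eq_one (h : IsQuadFundUnit ι φ d g r s) {q d' : ℕ} (hq : q.Prime) (hq4 : q % 4 = 3)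
    (hd : d = d' * q) (hqd : ¬ q ∣ d') : r ^ 2 - d * s ^ 2 = 1 := by
  obtain ⟨hn, T, hT⟩ := norm_trace_of_isIntegralUnit h.sq_eq φ h.conj_eq h.isUnit
  refine hn.resolve_right fun h1 ↦ ?_
  subst hd
  exact sq_sub_mul_sq_ne_neg_one hq hq4 hqd hT h1

lemma exists_eq_two_mul_sq (h : IsQuadFundUnit ι φ d g r s) (hd : d ≠ 0)
    (hn : r ^ 2 - d * s ^ 2 = 1) {c : ℕ} (hc : c ≠ 0) (hsq : PMSq c r) :
    ∃ w : L, (r : L) + s * g = 2 * c * w ^ 2 := by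
  have hr := h.one_lt_r hn hd
  exact exists_eq_two_mul_sq_of_pmSq h.sq_eq hn hr.ne' (by linarith) hc hsq

/-- For `d = pq` a product of two primes, either `r ± 1` is a square, or the fundamental unit of
norm one is `p` or `2p` up to squares. -/
lemma exists_eq_mul_sq (h : IsQuadFundUnit ι φ d g r s) {p q : ℕ} (hp : p.Prime) (hq : q.Prime)
    (hd : d = p * q) (hn : r ^ 2 - d * s ^ 2 = 1) (hsq : ¬ PMSq 1 r) :
    (∃ w : L, (r : L) + s * g = p * w ^ 2) ∨ (∃ w : L, (r : L) + s * g = 2 * p * w ^ 2) := by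
  have hd0 : d ≠ 0 := by rw [hd]; exact mul_ne_zero hp.ne_zero hq.ne_zero
  obtain ⟨T, hT⟩ := (norm_trace_of_isIntegralUnit h.sq_eq φ h.conj_eq h.isUnit).2
  obtain ⟨c, k, hc, hk, hck, hc1, hcd⟩ := h.exists_dvd hn hd0
  have hs := h.s_ne_zero
  have hkL : (k : L) ≠ 0 := by exact_mod_cast hk
  have hpL : (p : L) ≠ 0 := by exact_mod_cast hp.ne_zero
  have hqL : (q : L) ≠ 0 := by exact_mod_cast hq.ne_zero
  have hckL : 2 * ((r : L) + 1) = c * (k : L) ^ 2 := by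
    exact_mod_cast congrArg (Rat.cast : ℚ → L) hck
  have hE := two_mul_add_one_mul_eq_sq h.sq_eq hn
  rw [hckL] at hE
  have hg : g ^ 2 = (p : L) * q := by rw [h.sq_eq, hd]; push_cast; rfl
  have hkQ : (k : ℚ) ≠ 0 := by exact_mod_cast hk
  have hdQ : (d : ℚ) ≠ 0 := by exact_mod_cast hd0
  obtain ⟨c₁, c₂, h₁, h₂, rfl⟩ := (Nat.dvd_mul).1 hc
  rw [hd] at h₂
  obtain ⟨c₃, c₄, h₃, h₄, rfl⟩ := (Nat.dvd_mul).1 h₂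
  -- Of the eight divisors c of 2pq, 1 and pq would make ε a square, while 2 and 2pq make r + 1 or r
  -- - 1 a square. For the other four, p and q have the same class because pq = g².
  rcases (Nat.dvd_prime Nat.prime_two).1 h₁ with rfl | rfl <;>
    rcases (Nat.dvd_prime hp).1 h₃ with rfl | rfl <;>
    rcases (Nat.dvd_prime hq).1 h₄ with rfl | rfl
  · simp at hc1
  · left
    refine ⟨(r + 1 + s * g) / (k * g), ?_⟩
    have hg0 : g ≠ 0 := by rintro rfl; exact mul_ne_zero hpL hqL (by rw [← hg]; ring)
    rw [div_pow, ← hE, mul_pow, hg]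
    push_cast
    field_simp
  · left
    refine ⟨(r + 1 + s * g) / (k * c₃), ?_⟩
    rw [div_pow, ← hE]
    push_cast
    field_simp
  · simp [hd] at hcd
  · exfalso
    apply hsq
    left
    apply isNatSq_of_isSquare (T := T + 2)
    · push_cast; rw [← hT]; ring
    · exact ⟨k, by push_cast at hck ⊢; linear_combination (1 / 2 : ℚ) * hck⟩
  · right
    refine ⟨(r + 1 + s * g) / (2 * k * g), ?_⟩
    have hg0 : g ≠ 0 := by rintro rfl; exact mul_ne_zero hpL hqL (by rw [← hg]; ring)
    rw [div_pow, ← hE, mul_pow, hg]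
    push_cast
    field_simp
  · right
    refine ⟨(r + 1 + s * g) / (2 * k * c₃), ?_⟩
    rw [div_pow, ← hE]
    push_cast
    field_simp
  · exfalso
    apply hsq
    right
    apply isNatSq_of_isSquare (T := T - 2)
    · push_cast; rw [← hT]; ring
    · have h1 : r + 1 = d * k ^ 2 := by
        rw [hd]; push_cast at hck ⊢; linear_combination (1 / 2 : ℚ) * hck
      refine ⟨s / k, ?_⟩
      field_simp
      apply mul_left_cancel₀ hdQ
      push_cast
      linear_combination (1 - r) * h1 + hn

end IsQuadFundUnit

/-! ### Independence of the three units, and units that are rational up to squares. -/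

/-- Conjugates of the quadratic units of a biquadratic field, and the fact that a unit which is a
square up to a rational number is, up to sign, a product of these. -/
structure IsUnitTriple {L : Type*} [Field L] [CharZero L] (σ τ : L →+* L) (ι : L →+* ℝ)
    (E₁ E₂ E₃ : L) : Prop where
  σ_fst : σ E₁ = -E₁⁻¹
  τ_fst : τ E₁ = E₁
  σ_snd : σ E₂ = E₂
  τ_snd : τ E₂ = E₂⁻¹
  σ_trd : σ E₃ = E₃⁻¹
  τ_trd : τ E₃ = E₃⁻¹
  fst_gt : 1 < ι E₁
  snd_gt : 1 < ι E₂
  trd_gt : 1 < ι E₃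
  generates : ∀ {w v : L} {k : ℚ}, k ≠ 0 → IsIntegralUnit v → w ^ 2 = k * v →
    ∃ a b c : ℤ, v = E₁ ^ a * E₂ ^ b * E₃ ^ c ∨ v = -(E₁ ^ a * E₂ ^ b * E₃ ^ c)

namespace IsUnitTriple

variable {L : Type*} [Field L] [CharZero L] {σ τ : L →+* L} {ι : L →+* ℝ} {E₁ E₂ E₃ : L}

lemma eq_one_of_mul_eq_one {A B C : ℝ} (hA : 0 < A) (h₁ : A * B * C = 1) (h₂ : A * B⁻¹ * C⁻¹ = 1) :
    A = 1 := by
  have hB : B ≠ 0 := by rintro rfl; simp at h₁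
  have hC : C ≠ 0 := by rintro rfl; simp at h₁
  have h3 : A ^ 2 = 1 := by
    have : A ^ 2 = (A * B * C) * (A * B⁻¹ * C⁻¹) := by field_simp
    rw [this, h₁, h₂, one_mul]
  nlinarith

/-- Multiplying the relation by its image under τ, which fixes E₁ and inverts E₂, E₃, isolates E₁.
Then σ, which fixes E₂ and inverts E₃, isolates E₂. -/
lemma indep (h : IsUnitTriple σ τ ι E₁ E₂ E₃) {a b c : ℤ}
    (habc : ι E₁ ^ a * ι E₂ ^ b * ι E₃ ^ c = 1) : a = 0 ∧ b = 0 ∧ c = 0 := by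
  have p₁ : 0 < ι E₁ := by linarith [h.fst_gt]
  have p₂ : 0 < ι E₂ := by linarith [h.snd_gt]
  have p₃ : 0 < ι E₃ := by linarith [h.trd_gt]
  have zero_of {x : ℝ} (hx : 1 < x) {n : ℤ} (hn : x ^ n = 1) : n = 0 := by
    apply zpow_right_injective₀ (by linarith) hx.ne'
    simpa using hn
  have hL : E₁ ^ a * E₂ ^ b * E₃ ^ c = 1 := by
    apply ι.injective
    simpa [map_zpow₀] using habc
  have hτ := congrArg (fun x ↦ ι (τ x)) hL
  simp only [map_mul, map_zpow₀, h.τ_fst, h.τ_snd, h.τ_trd, map_inv₀, map_one, inv_zpow] at hτ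
  have ha : a = 0 := zero_of h.fst_gt (eq_one_of_mul_eq_one (by positivity) habc hτ)
  subst ha
  have hσ := congrArg (fun x ↦ ι (σ x)) hL
  simp only [map_mul, map_zpow₀, h.σ_snd, h.σ_trd, map_inv₀, map_one, inv_zpow,
    zpow_zero, one_mul] at hσ habc
  have hb : b = 0 := zero_of h.snd_gt
    (eq_one_of_mul_eq_one (B := 1) (C := ι E₃ ^ c) (by positivity) (by simpa using habc)
      (by simpa using hσ))
  subst hb
  exact ⟨rfl, rfl, zero_of h.trd_gt (by simpa using habc)⟩

/-- A unit which is a positive rational number up to squares is a product of powers of the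
quadratic units, the first one occurring with an even exponent. -/
theorem eq_prod (h : IsUnitTriple σ τ ι E₁ E₂ E₃) {w v : L} {k : ℚ} (hk : 0 < k)
    (hv : IsIntegralUnit v) (hw : w ^ 2 = k * v) :
    ∃ a b c : ℤ, v = E₁ ^ (2 * a) * E₂ ^ b * E₃ ^ c := by
  have p₁ : 0 < ι E₁ := by linarith [h.fst_gt]
  have p₂ : 0 < ι E₂ := by linarith [h.snd_gt]
  have p₃ : 0 < ι E₃ := by linarith [h.trd_gt]
  have hkR : (0 : ℝ) < k := by exact_mod_cast hk
  -- Total positivity of v, a square divided by k > 0.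
  have hpos (φ : L →+* L) : 0 < ι (φ v) := by
    have h1 := congrArg (fun x ↦ ι (φ x)) hw
    simp only [map_pow, map_mul, map_ratCast] at h1
    have h2 : 0 ≤ (k : ℝ) * ι (φ v) := by rw [← h1]; positivity
    have h3 : 0 ≤ ι (φ v) := nonneg_of_mul_nonneg_right h2 hkR
    exact lt_of_le_of_ne h3 (Ne.symm ((map_ne_zero _).2 ((map_ne_zero _).2 hv.1)))
  obtain ⟨a, b, c, habc⟩ := h.generates hk.ne' hv hw
  have habc' : v = E₁ ^ a * E₂ ^ b * E₃ ^ c := by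
    refine habc.resolve_right fun h1 ↦ ?_
    have h2 := hpos (RingHom.id L)
    rw [RingHom.id_apply, h1] at h2
    simp only [map_neg, map_mul, map_zpow₀] at h2
    have : 0 < ι E₁ ^ a * ι E₂ ^ b * ι E₃ ^ c := by positivity
    linarith
  rcases Int.even_or_odd a with ⟨a', ha'⟩ | ha
  · exact ⟨a', b, c, by rw [habc', ha', two_mul]⟩
  -- An odd power of E₁ becomes negative under σ, as σ(E₁) = -1/E₁.
  · exfalso
    have h2 := hpos σ
    rw [habc'] at h2
    simp only [map_mul, map_zpow₀, h.σ_fst, h.σ_snd, h.σ_trd, map_inv₀, map_neg,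
      ha.neg_zpow] at h2
    have : 0 < (ι E₁)⁻¹ ^ a * ι E₂ ^ b * (ι E₃)⁻¹ ^ c := by positivity
    linarith

end IsUnitTriple

/-- The action on the units is dictated by their norms: -1 for the prime p ≡ 1 mod 4, and 1 for the
two radicands divisible exactly once by q ≡ 3 mod 4. -/
theorem BiquadraticData.HasFundUnits.isUnitTriple {L : Type*} [Field L] [CharZero L] {p n d q : ℕ}
    {D : BiquadraticData L p n} {r₁ s₁ r₂ s₂ r₃ s₃ : ℚ}
    (H : D.HasFundUnits r₁ s₁ r₂ s₂ r₃ s₃) (hp : p.Prime) (hp4 : p % 4 = 1) (hq : q.Prime)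
    (hq4 : q % 4 = 3) (hn : n = d * q) (hqd : ¬ q ∣ d) :
    IsUnitTriple D.σ D.τ D.ι (r₁ + s₁ * D.e) (r₂ + s₂ * D.f) (r₃ + s₃ * (D.e * D.f)) := by
  have hqp : ¬ q ∣ p := by
    intro h
    have := (Nat.prime_dvd_prime_iff_eq hq hp).1 h
    omega
  have n₁ := H.fst.norm_eq_neg_one hp hp4
  have n₂ := H.snd.norm_eq_one hq hq4 hn hqd
  have n₃ := H.trd.norm_eq_one hq hq4 (d' := p * d) (by rw [hn]; ring)
    (fun h ↦ (hq.dvd_mul.1 h).elim hqp hqd)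
  have m₁ := mul_conj_eq_ratCast H.fst.sq_eq _ H.fst.conj_eq r₁ s₁
  have m₂ := mul_conj_eq_ratCast H.snd.sq_eq _ H.snd.conj_eq r₂ s₂
  have m₃ := mul_conj_eq_ratCast H.trd.sq_eq _ H.trd.conj_eq r₃ s₃
  rw [n₁] at m₁
  rw [n₂] at m₂
  rw [n₃] at m₃
  have hσ₃ : D.σ (r₃ + s₃ * (D.e * D.f)) = ((r₃ : L) + s₃ * (D.e * D.f))⁻¹ :=
    eq_inv_of_mul_eq_one_right (by rw [m₃, Rat.cast_one])
  exact
  { σ_fst := by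
      rw [← neg_eq_iff_eq_neg]
      exact eq_inv_of_mul_eq_one_right (by rw [mul_neg, m₁]; simp)
    τ_fst := by simp [D.τ_e]
    σ_snd := by simp [D.σ_f]
    τ_snd := eq_inv_of_mul_eq_one_right (by rw [m₂, Rat.cast_one])
    σ_trd := hσ₃
    τ_trd := by rw [← hσ₃]; simp [D.τ_e, D.τ_f, D.σ_e, D.σ_f]
    fst_gt := H.fst.one_lt
    snd_gt := H.snd.one_lt
    trd_gt := H.trd.one_lt
    generates := fun hk hv hw ↦ by
      obtain ⟨a, b, c, h⟩ := BiquadraticData.exists_eq_prod_quadratic_units H hk hv hw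
      rw [hσ₃] at h
      exact ⟨a, b, -c, by simpa [zpow_neg] using h⟩ }

lemma not_isSquare_of_eq_mul_sq {L : Type*} [Field L] {x c g : L} (hx : x ≠ 0) (hc : ¬ IsSquare c)
    (h : x = c * g ^ 2) : ¬ IsSquare x := by
  rintro ⟨y, hy⟩
  have hg : g ≠ 0 := by rintro rfl; apply hx; rw [h]; ring
  refine hc ⟨y / g, ?_⟩
  field_simp
  rw [← h, hy]; ring

namespace IsUnitTriple

variable {L : Type*} [Field L] [CharZero L] {σ τ : L →+* L} {ι : L →+* ℝ} {E₁ E₂ E₃ : L}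

lemma fst_ne_zero (h : IsUnitTriple σ τ ι E₁ E₂ E₃) : E₁ ≠ 0 := by
  rintro rfl; have := h.fst_gt; rw [map_zero] at this; linarith

lemma snd_ne_zero (h : IsUnitTriple σ τ ι E₁ E₂ E₃) : E₂ ≠ 0 := by
  rintro rfl; have := h.snd_gt; rw [map_zero] at this; linarith

lemma trd_ne_zero (h : IsUnitTriple σ τ ι E₁ E₂ E₃) : E₃ ≠ 0 := by
  rintro rfl; have := h.trd_gt; rw [map_zero] at this; linarith

/-- A unit which is a positive rational number `k` up to squares is a square times one of `1`, `E₂`,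
`E₃`, `E₂E₃`. -/
theorem eq_sq_mul (h : IsUnitTriple σ τ ι E₁ E₂ E₃) {w v : L} {k : ℚ} (hk : 0 < k)
    (hv : IsIntegralUnit v) (hw : w ^ 2 = k * v) : ∃ a b c : ℤ,
      (v = (E₁ ^ a * E₂ ^ b * E₃ ^ c) ^ 2 ∧ IsSquare (k : L)) ∨
      (v = (E₁ ^ a * E₂ ^ b * E₃ ^ c) ^ 2 * E₂ ∧ IsSquare (k * E₂ : L)) ∨
      (v = (E₁ ^ a * E₂ ^ b * E₃ ^ c) ^ 2 * E₃ ∧ IsSquare (k * E₃ : L)) ∨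
      (v = (E₁ ^ a * E₂ ^ b * E₃ ^ c) ^ 2 * (E₂ * E₃) ∧ IsSquare (k * (E₂ * E₃) : L)) := by
  have h₁ := h.fst_ne_zero
  have h₂ := h.snd_ne_zero
  have h₃ := h.trd_ne_zero
  have aux (a b c : ℤ) (x : L) (hx : v = (E₁ ^ a * E₂ ^ b * E₃ ^ c) ^ 2 * x) :
      IsSquare (k * x) := by
    have hg : E₁ ^ a * E₂ ^ b * E₃ ^ c ≠ 0 := by positivity
    refine ⟨w / (E₁ ^ a * E₂ ^ b * E₃ ^ c), ?_⟩
    generalize E₁ ^ a * E₂ ^ b * E₃ ^ c = g at hx hg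
    field_simp
    rw [hw, hx]; ring
  obtain ⟨a, b, c, habc⟩ := h.eq_prod hk hv hw
  have two (x : L) (n : ℤ) : x ^ (2 * n) = (x ^ n) ^ 2 := by
    rw [mul_comm, zpow_mul]; norm_cast
  rcases Int.even_or_odd' b with ⟨b', rfl | rfl⟩ <;> rcases Int.even_or_odd' c with ⟨c', rfl | rfl⟩
  all_goals
    refine ⟨a, b', c', ?_⟩
    simp only [zpow_add₀ h₂, zpow_add₀ h₃, two, zpow_one] at habc
  · have hx : v = (E₁ ^ a * E₂ ^ b' * E₃ ^ c') ^ 2 * 1 := by rw [habc]; ring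
    exact .inl ⟨by simpa using hx, by simpa using aux _ _ _ _ hx⟩
  · have hx : v = (E₁ ^ a * E₂ ^ b' * E₃ ^ c') ^ 2 * E₃ := by rw [habc]; ring
    exact .inr (.inr (.inl ⟨hx, aux _ _ _ _ hx⟩))
  · have hx : v = (E₁ ^ a * E₂ ^ b' * E₃ ^ c') ^ 2 * E₂ := by rw [habc]; ring
    exact .inr (.inl ⟨hx, aux _ _ _ _ hx⟩)
  · have hx : v = (E₁ ^ a * E₂ ^ b' * E₃ ^ c') ^ 2 * (E₂ * E₃) := by rw [habc]; ring
    exact .inr (.inr (.inr ⟨hx, aux _ _ _ _ hx⟩))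

/-- Apply `eq_sq_mul` to u² with k = 1: only the alternative that u² is the square of a product of
the Eⱼ survives. -/
lemma exists_eq_of_not_isSquare (h : IsUnitTriple σ τ ι E₁ E₂ E₃) (h₂ : ¬ IsSquare E₂)
    (h₃ : ¬ IsSquare E₃) (h₂₃ : ¬ IsSquare (E₂ * E₃)) {u : L} (hu : IsIntegralUnit u) :
    ∃ a b c : ℤ, u = E₁ ^ a * E₂ ^ b * E₃ ^ c ∨ u = -(E₁ ^ a * E₂ ^ b * E₃ ^ c) := by
  obtain ⟨a, b, c, ⟨hg, -⟩ | ⟨-, hg⟩ | ⟨-, hg⟩ | ⟨-, hg⟩⟩ :=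
    h.eq_sq_mul (w := u) (v := u ^ 2) one_pos (by rw [sq]; exact hu.mul hu) (by simp)
  · exact ⟨a, b, c, sq_eq_sq_iff_eq_or_eq_neg.1 hg⟩
  all_goals simp_all

lemma exists_eq_of_sq_eq_mul (h : IsUnitTriple σ τ ι E₁ E₂ E₃) (h₂ : ¬ IsSquare E₂)
    (h₃ : ¬ IsSquare E₃) {R : L} (hR : R ^ 2 = E₂ * E₃) {u : L} (hu : IsIntegralUnit u) :
    ∃ a b c : ℤ, u = E₁ ^ a * E₂ ^ b * R ^ c ∨ u = -(E₁ ^ a * E₂ ^ b * R ^ c) := by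
  have n₂ := h.snd_ne_zero
  have hR0 : R ≠ 0 := by
    rintro rfl
    exact mul_ne_zero h.snd_ne_zero h.trd_ne_zero (by rw [← hR]; ring)
  have h₃' : E₃ = R ^ (2 : ℤ) * E₂⁻¹ := by
    rw [show R ^ (2 : ℤ) = R ^ 2 by norm_cast, hR]; field_simp
  obtain ⟨a, b, c, ⟨hg, -⟩ | ⟨-, hg⟩ | ⟨-, hg⟩ | ⟨hg, -⟩⟩ :=
    h.eq_sq_mul (w := u) (v := u ^ 2) one_pos (by rw [sq]; exact hu.mul hu) (by simp)
  -- From E₃ = R²/E₂ one gets E₂^b E₃^c = E₂^(b-c) R^(2c); a remaining factor E₂E₃ of u² contributes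
  -- one more R to u.
  · refine ⟨a, b - c, 2 * c, sq_eq_sq_iff_eq_or_eq_neg.1 ?_⟩
    rw [hg, h₃', mul_zpow, ← zpow_mul, inv_zpow, zpow_sub₀ n₂]
    ring
  · exact absurd (by simpa using hg) h₂
  · exact absurd (by simpa using hg) h₃
  · refine ⟨a, b - c, 2 * c + 1, sq_eq_sq_iff_eq_or_eq_neg.1 ?_⟩
    rw [hg, ← hR, h₃', mul_zpow, ← zpow_mul, inv_zpow, zpow_sub₀ n₂, zpow_add_one₀ hR0]
    ring

lemma exists_eq_of_sq_eq (h : IsUnitTriple σ τ ι E₁ E₂ E₃) (h₂ : ¬ IsSquare E₂)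
    (h₂₃ : ¬ IsSquare (E₂ * E₃)) {R : L} (hR : R ^ 2 = E₃) {u : L} (hu : IsIntegralUnit u) :
    ∃ a b c : ℤ, u = E₁ ^ a * E₂ ^ b * R ^ c ∨ u = -(E₁ ^ a * E₂ ^ b * R ^ c) := by
  have hR0 : R ≠ 0 := by
    rintro rfl
    exact h.trd_ne_zero (by rw [← hR]; ring)
  have h₃' : E₃ = R ^ (2 : ℤ) := by
    rw [show R ^ (2 : ℤ) = R ^ 2 by norm_cast, hR]
  obtain ⟨a, b, c, ⟨hg, -⟩ | ⟨-, hg⟩ | ⟨hg, -⟩ | ⟨-, hg⟩⟩ :=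
    h.eq_sq_mul (w := u) (v := u ^ 2) one_pos (by rw [sq]; exact hu.mul hu) (by simp)
  · refine ⟨a, b, 2 * c, sq_eq_sq_iff_eq_or_eq_neg.1 ?_⟩
    rw [hg, h₃', ← zpow_mul]
  · exact absurd (by simpa using hg) h₂
  · refine ⟨a, b, 2 * c + 1, sq_eq_sq_iff_eq_or_eq_neg.1 ?_⟩
    rw [hg, ← hR, show (R ^ 2) ^ c = R ^ (2 * c) by rw [zpow_mul]; norm_cast, zpow_add_one₀ hR0]
    ring
  · exact absurd (by simpa using hg) h₂₃

/-- The case k = 2 of `eq_sq_mul`: a finite test for the Hasse index to be 1. -/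
lemma not_sq_eq_two_mul (h : IsUnitTriple σ τ ι E₁ E₂ E₃) (h₀ : ¬ IsSquare (2 : L))
    (h₂ : ¬ IsSquare (2 * E₂)) (h₃ : ¬ IsSquare (2 * E₃)) (h₂₃ : ¬ IsSquare (2 * (E₂ * E₃)))
    {w v : L} (hv : IsIntegralUnit v) : w ^ 2 ≠ 2 * v := by
  intro hw
  obtain ⟨a, b, c, ⟨-, hg⟩ | ⟨-, hg⟩ | ⟨-, hg⟩ | ⟨-, hg⟩⟩ :=
    h.eq_sq_mul (w := w) (v := v) (k := 2) two_pos hv (by simpa using hw)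
  all_goals simp_all

end IsUnitTriple

/-! ### Quadratic extensions inside `ℂ` -/

/-- Adjoining a square root. -/
lemma mem_sup_adjoin_iff {F : IntermediateField ℚ ℂ} {e : ℂ} (he : e ^ 2 ∈ F) {z : ℂ} :
    z ∈ F ⊔ IntermediateField.adjoin ℚ {e} ↔ ∃ α ∈ F, ∃ β ∈ F, z = α + β * e := by
  have heS : e ∈ F ⊔ IntermediateField.adjoin ℚ {e} :=
    (le_sup_right (a := F)) (IntermediateField.mem_adjoin_simple_self ℚ e)
  constructor
  · by_cases heF : e ∈ F
    · intro hz
      have : F ⊔ IntermediateField.adjoin ℚ {e} = F := by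
        rw [sup_eq_left, IntermediateField.adjoin_simple_le_iff]; exact heF
      rw [this] at hz
      exact ⟨z, hz, 0, zero_mem F, by simp⟩
    · let S : IntermediateField ℚ ℂ :=
        { carrier := {z | ∃ α ∈ F, ∃ β ∈ F, z = α + β * e}
          mul_mem' := by
            rintro _ _ ⟨α, hα, β, hβ, rfl⟩ ⟨γ, hγ, δ, hδ, rfl⟩
            exact ⟨α * γ + β * δ * e ^ 2, add_mem (mul_mem hα hγ) (mul_mem (mul_mem hβ hδ) he),
              α * δ + β * γ, add_mem (mul_mem hα hδ) (mul_mem hβ hγ), by ring⟩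
          add_mem' := by
            rintro _ _ ⟨α, hα, β, hβ, rfl⟩ ⟨γ, hγ, δ, hδ, rfl⟩
            exact ⟨α + γ, add_mem hα hγ, β + δ, add_mem hβ hδ, by ring⟩
          algebraMap_mem' := fun r ↦ ⟨algebraMap ℚ ℂ r, F.algebraMap_mem r, 0, zero_mem F, by simp⟩
          inv_mem' := by
            rintro _ ⟨α, hα, β, hβ, rfl⟩
            by_cases hβ0 : β = 0
            · exact ⟨α⁻¹, inv_mem hα, 0, zero_mem F, by simp [hβ0]⟩
            have h1 : α + β * e ≠ 0 := by
              intro h0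
              apply heF
              have : e = -α / β := by field_simp; linear_combination h0
              rw [this]
              exact div_mem (neg_mem hα) hβ
            have h2 : α - β * e ≠ 0 := by
              intro h0
              apply heF
              have : e = α / β := by field_simp; linear_combination -h0
              rw [this]
              exact div_mem hα hβ
            have hN : α ^ 2 - β ^ 2 * e ^ 2 ∈ F :=
              sub_mem (pow_mem hα 2) (mul_mem (pow_mem hβ 2) he)
            refine ⟨α / (α ^ 2 - β ^ 2 * e ^ 2), div_mem hα hN, -β / (α ^ 2 - β ^ 2 * e ^ 2),
              div_mem (neg_mem hβ) hN, ?_⟩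
            have h3 : α ^ 2 - β ^ 2 * e ^ 2 = (α + β * e) * (α - β * e) := by ring
            rw [h3]
            field_simp
            ring }
      have hle : F ⊔ IntermediateField.adjoin ℚ {e} ≤ S := by
        rw [sup_le_iff, IntermediateField.adjoin_simple_le_iff]
        exact ⟨fun x hx ↦ ⟨x, hx, 0, zero_mem F, by simp⟩, ⟨0, zero_mem F, 1, one_mem F, by simp⟩⟩
      exact fun hz ↦ hle hz
  · rintro ⟨α, hα, β, hβ, rfl⟩
    exact add_mem (le_sup_left (a := F) hα) (mul_mem (le_sup_left (a := F) hβ) heS)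

/-- The nontrivial automorphism of a quadratic extension. -/
lemma exists_conj_of_adjoin_sqrt {F L : IntermediateField ℚ ℂ} {e : ℂ} (he : e ^ 2 ∈ F)
    (heF : e ∉ F) (hL : ∀ z, z ∈ L ↔ ∃ α ∈ F, ∃ β ∈ F, z = α + β * e) :
    ∃ φ : L →+* L, (∀ z : L, (z : ℂ) ∈ F → φ z = z) ∧ ∀ z : L, (z : ℂ) = e → φ z = -z := by
  choose A hA B hB hAB using fun z : L ↦ (hL z).1 z.2
  have uniq {α β γ δ : ℂ} (hα : α ∈ F) (hβ : β ∈ F) (hγ : γ ∈ F) (hδ : δ ∈ F)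
      (h : α + β * e = γ + δ * e) : α = γ ∧ β = δ := by
    have hβδ : β = δ := by
      by_contra hne
      apply heF
      have h1 : β - δ ≠ 0 := sub_ne_zero.2 hne
      have : e = (γ - α) / (β - δ) := by field_simp; linear_combination h
      rw [this]
      exact div_mem (sub_mem hγ hα) (sub_mem hβ hδ)
    subst hβδ
    exact ⟨by linear_combination h, rfl⟩
  -- The coordinates A, B are arbitrary choices; uniqueness lets each ring axiom be checked on any
  -- convenient representation.
  have val (z : L) {α β : ℂ} (hα : α ∈ F) (hβ : β ∈ F) (h : (z : ℂ) = α + β * e) :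
      A z - B z * e = α - β * e := by
    obtain ⟨h1, h2⟩ := uniq (hA z) (hB z) hα hβ (by rw [← hAB, h])
    rw [h1, h2]
  let φ : L →+* L :=
    { toFun := fun z ↦ ⟨A z - B z * e, (hL _).2 ⟨A z, hA z, -B z, neg_mem (hB z), by ring⟩⟩
      map_one' := Subtype.ext
        ((val 1 (one_mem F) (zero_mem F) (by simp)).trans (by simp))
      map_zero' := Subtype.ext
        ((val 0 (zero_mem F) (zero_mem F) (by simp)).trans (by simp))
      map_add' := fun x y ↦ Subtype.ext
        ((val (x + y) (add_mem (hA x) (hA y)) (add_mem (hB x) (hB y))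
          (by push_cast; rw [hAB x, hAB y]; ring)).trans (by push_cast; ring))
      map_mul' := fun x y ↦ Subtype.ext
        ((val (x * y) (add_mem (mul_mem (hA x) (hA y)) (mul_mem (mul_mem (hB x) (hB y)) he))
          (add_mem (mul_mem (hA x) (hB y)) (mul_mem (hB x) (hA y)))
          (by push_cast; rw [hAB x, hAB y]; ring)).trans (by push_cast; ring)) }
  refine ⟨φ, fun z hz ↦ Subtype.ext ?_, fun z hz ↦ Subtype.ext ?_⟩
  · exact (val z hz (zero_mem F) (by simp)).trans (by simp)
  · exact (val z (zero_mem F) (one_mem F) (by simp [hz])).trans (by simp [hz])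

lemma sqrt_natCast_sq (m : ℕ) : ((√(m : ℝ) : ℝ) : ℂ) ^ 2 = m := by
  rw [← Complex.ofReal_pow, Real.sq_sqrt (by positivity)]; simp

lemma mem_quadraticField_iff {m : ℕ} {z : ℂ} :
    z ∈ quadraticField m ↔ ∃ r s : ℚ, z = r + s * ((√(m : ℝ) : ℝ) : ℂ) := by
  have h : quadraticField m = ⊥ ⊔ IntermediateField.adjoin ℚ {((√(m : ℝ) : ℝ) : ℂ)} := by
    rw [bot_sup_eq]; rfl
  rw [h, mem_sup_adjoin_iff (by rw [sqrt_natCast_sq]; exact natCast_mem _ m)]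
  constructor
  · rintro ⟨α, hα, β, hβ, rfl⟩
    obtain ⟨r, rfl⟩ := IntermediateField.mem_bot.1 hα
    obtain ⟨s, rfl⟩ := IntermediateField.mem_bot.1 hβ
    exact ⟨r, s, by simp⟩
  · rintro ⟨r, s, rfl⟩
    exact ⟨r, IntermediateField.mem_bot.2 ⟨r, by simp⟩, s, IntermediateField.mem_bot.2 ⟨s, by simp⟩,
      rfl⟩

lemma sqrt_mem_quadraticField (m : ℕ) : ((√(m : ℝ) : ℝ) : ℂ) ∈ quadraticField m :=
  IntermediateField.mem_adjoin_simple_self ℚ _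

lemma biquadraticField_eq_sup (m n : ℕ) :
    biquadraticField m n = quadraticField m ⊔ quadraticField n := by
  rw [biquadraticField, quadraticField, quadraticField, ← IntermediateField.adjoin_union,
    Set.singleton_union]

lemma mem_biquadraticField_iff {m n : ℕ} {z : ℂ} :
    z ∈ biquadraticField m n ↔ ∃ α ∈ quadraticField m, ∃ β ∈ quadraticField m,
      z = α + β * ((√(n : ℝ) : ℝ) : ℂ) := by
  rw [biquadraticField_eq_sup]
  exact mem_sup_adjoin_iff (by rw [sqrt_natCast_sq]; exact natCast_mem _ n)

lemma biquadraticField_comm (m n : ℕ) : biquadraticField m n = biquadraticField n m := by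
  rw [biquadraticField_eq_sup, biquadraticField_eq_sup, sup_comm]

lemma exists_coords_of_mem_biquadraticField {m n : ℕ} {z : ℂ} (hz : z ∈ biquadraticField m n) :
    ∃ r s t u : ℚ, z = r + s * ((√(m : ℝ) : ℝ) : ℂ) + t * ((√(n : ℝ) : ℝ) : ℂ) +
      u * (((√(m : ℝ) : ℝ) : ℂ) * ((√(n : ℝ) : ℝ) : ℂ)) := by
  obtain ⟨α, hα, β, hβ, rfl⟩ := mem_biquadraticField_iff.1 hz
  obtain ⟨r, s, rfl⟩ := mem_quadraticField_iff.1 hα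
  obtain ⟨t, u, rfl⟩ := mem_quadraticField_iff.1 hβ
  exact ⟨r, s, t, u, by ring⟩

lemma conj_eq_of_mem_biquadraticField {m n : ℕ} {z : ℂ} (hz : z ∈ biquadraticField m n) :
    conj z = z := by
  obtain ⟨r, s, t, u, rfl⟩ := exists_coords_of_mem_biquadraticField hz
  simp

/-- Squaring √n = r + s√m makes √m rational unless rs = 0; r = 0 makes mn a square and s = 0 makes n
one. -/
lemma sqrt_not_mem_quadraticField {m n : ℕ} (hm : ¬ IsSquare (m : ℚ)) (hn : ¬ IsSquare (n : ℚ))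
    (hmn : ¬ IsSquare ((m * n : ℕ) : ℚ)) : ((√(n : ℝ) : ℝ) : ℂ) ∉ quadraticField m := by
  intro h
  obtain ⟨r, s, hrs⟩ := mem_quadraticField_iff.1 h
  have h1 : √(n : ℝ) = r + s * √(m : ℝ) := by exact_mod_cast hrs
  have hsm : √(m : ℝ) ^ 2 = m := Real.sq_sqrt (by positivity)
  have hsn : √(n : ℝ) ^ 2 = n := Real.sq_sqrt (by positivity)
  have h2 : (n : ℝ) = r ^ 2 + s ^ 2 * m + 2 * r * s * √(m : ℝ) := by
    rw [← hsn, h1]; linear_combination (s : ℝ) ^ 2 * hsm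
  by_cases hr : r = 0
  · apply hmn
    refine ⟨s * m, ?_⟩
    have : ((m * n : ℕ) : ℝ) = ((s * m * (s * m) : ℚ) : ℝ) := by
      push_cast; rw [h2, hr]; push_cast; ring
    exact_mod_cast this
  by_cases hs : s = 0
  · apply hn
    refine ⟨r, ?_⟩
    have : (n : ℝ) = ((r * r : ℚ) : ℝ) := by
      rw [h2, hs]; push_cast; ring
    exact_mod_cast this
  · apply hm
    refine ⟨(n - r ^ 2 - s ^ 2 * m) / (2 * r * s), ?_⟩
    have hr' : (r : ℝ) ≠ 0 := by exact_mod_cast hr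
    have hs' : (s : ℝ) ≠ 0 := by exact_mod_cast hs
    have h3 : √(m : ℝ) = (((n - r ^ 2 - s ^ 2 * m) / (2 * r * s) : ℚ) : ℝ) := by
      push_cast; field_simp; linear_combination -h2
    have : (m : ℝ) = (((n - r ^ 2 - s ^ 2 * m) / (2 * r * s) *
        ((n - r ^ 2 - s ^ 2 * m) / (2 * r * s)) : ℚ) : ℝ) := by
      rw [Rat.cast_mul, ← h3, ← sq, hsm]
    exact_mod_cast this

/-- The biquadratic field `ℚ(√m, √n)` with its automorphisms and its real embedding. -/
lemma exists_biquadraticData {m n : ℕ} (hm : ¬ IsSquare (m : ℚ)) (hn : ¬ IsSquare (n : ℚ))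
    (hmn : ¬ IsSquare ((m * n : ℕ) : ℚ)) : ∃ D : BiquadraticData (biquadraticField m n) m n,
      (D.e : ℂ) = (√(m : ℝ) : ℝ) ∧ (D.f : ℂ) = (√(n : ℝ) : ℝ) ∧
      ∀ w : biquadraticField m n, (w : ℂ) = (D.ι w : ℝ) := by
  have hmem : ((√(m : ℝ) : ℝ) : ℂ) ∈ biquadraticField m n := by
    rw [biquadraticField_eq_sup]
    exact le_sup_left (a := quadraticField m) (sqrt_mem_quadraticField m)
  have hmem' : ((√(n : ℝ) : ℝ) : ℂ) ∈ biquadraticField m n := by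
    rw [biquadraticField_eq_sup]
    exact le_sup_right (a := quadraticField m) (sqrt_mem_quadraticField n)
  obtain ⟨τ, hτ, hτ'⟩ := exists_conj_of_adjoin_sqrt (F := quadraticField m)
    (L := biquadraticField m n) (e := (√(n : ℝ) : ℝ))
    (by rw [sqrt_natCast_sq]; exact natCast_mem _ n) (sqrt_not_mem_quadraticField hm hn hmn)
    (fun z ↦ mem_biquadraticField_iff)
  obtain ⟨σ, hσ, hσ'⟩ := exists_conj_of_adjoin_sqrt (F := quadraticField n)
    (L := biquadraticField m n) (e := (√(m : ℝ) : ℝ))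
    (by rw [sqrt_natCast_sq]; exact natCast_mem _ m)
    (sqrt_not_mem_quadraticField hn hm (by rwa [mul_comm]))
    (fun z ↦ by rw [biquadraticField_comm]; exact mem_biquadraticField_iff)
  have him (w : biquadraticField m n) : ((w : ℂ).re : ℂ) = w :=
    Complex.conj_eq_iff_re.1 (conj_eq_of_mem_biquadraticField w.2)
  have him0 (w : biquadraticField m n) : (w : ℂ).im = 0 :=
    Complex.conj_eq_iff_im.1 (conj_eq_of_mem_biquadraticField w.2)
  let ι : biquadraticField m n →+* ℝ :=
    { toFun := fun w ↦ (w : ℂ).re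
      map_one' := by simp
      map_zero' := by simp
      map_add' := fun x y ↦ by simp
      map_mul' := fun x y ↦ by simp [him0] }
  refine ⟨{ e := ⟨_, hmem⟩, f := ⟨_, hmem'⟩, σ := σ, τ := τ, ι := ι
            e_sq := Subtype.ext (by push_cast; exact sqrt_natCast_sq m)
            f_sq := Subtype.ext (by push_cast; exact sqrt_natCast_sq n)
            σ_e := hσ' _ rfl, σ_f := hσ _ (sqrt_mem_quadraticField n)
            τ_e := hτ _ (sqrt_mem_quadraticField m), τ_f := hτ' _ rfl
            coords := fun w ↦ ?_ }, rfl, rfl, fun w ↦ (him w).symm⟩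
  obtain ⟨r, s, t, u, h⟩ := exists_coords_of_mem_biquadraticField w.2
  exact ⟨r, s, t, u, Subtype.ext (by push_cast; exact h)⟩

/-- √(p₁p₂q) is the product of √p₁ ≠ 0 and √(p₂q), so each of the two radicals √(p₁p₂q), √(p₂q) is
obtained from the other and √p₁. -/
lemma fieldK1_eq_sup {p₁ p₂ q : ℕ} (hp₁ : p₁ ≠ 0) :
    fieldK1 p₁ p₂ q = biquadraticField p₁ (p₂ * q) ⊔ IntermediateField.adjoin ℚ {Complex.I} := by
  have hmul : ((√((p₁ * p₂ * q : ℕ) : ℝ) : ℝ) : ℂ) =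
      ((√(p₁ : ℝ) : ℝ) : ℂ) * ((√((p₂ * q : ℕ) : ℝ) : ℝ) : ℂ) := by
    rw [← Complex.ofReal_mul, ← Real.sqrt_mul (by positivity)]
    push_cast
    rw [mul_assoc]
  have hne : ((√(p₁ : ℝ) : ℝ) : ℂ) ≠ 0 := by
    rw [Complex.ofReal_ne_zero]
    have : 0 < (p₁ : ℝ) := by positivity
    positivity
  have hgauss (d : ℕ) : gaussianQuadraticField d =
      quadraticField d ⊔ IntermediateField.adjoin ℚ {Complex.I} := by
    rw [gaussianQuadraticField, quadraticField, ← IntermediateField.adjoin_union,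
      Set.singleton_union]
  rw [fieldK1, hgauss, biquadraticField_eq_sup]
  apply le_antisymm
  · refine sup_le (sup_le ?_ le_sup_right) (le_sup_left.trans le_sup_left)
    rw [quadraticField, IntermediateField.adjoin_simple_le_iff, hmul]
    exact le_sup_left (a := quadraticField p₁ ⊔ quadraticField (p₂ * q)) (mul_mem
      (le_sup_left (a := quadraticField p₁) (sqrt_mem_quadraticField p₁))
      (le_sup_right (a := quadraticField p₁) (sqrt_mem_quadraticField _)))
  · refine sup_le (sup_le le_sup_right ?_) (le_sup_right.trans le_sup_left)
    rw [quadraticField, IntermediateField.adjoin_simple_le_iff]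
    have : ((√((p₂ * q : ℕ) : ℝ) : ℝ) : ℂ) =
        ((√((p₁ * p₂ * q : ℕ) : ℝ) : ℝ) : ℂ) / ((√(p₁ : ℝ) : ℝ) : ℂ) := by
      rw [hmul]; field_simp
    rw [this]
    exact div_mem (le_sup_left (a := quadraticField (p₁ * p₂ * q) ⊔ _)
      (le_sup_left (a := quadraticField (p₁ * p₂ * q)) (sqrt_mem_quadraticField _)))
      (le_sup_right (a := quadraticField (p₁ * p₂ * q) ⊔ _) (sqrt_mem_quadraticField p₁))

/-! ### The CM field F(i) and its Hasse unit index. -/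

/-- `K = F(i)` for a totally real field `F`. -/
structure IsGaussianExtension (F K : IntermediateField ℚ ℂ) : Prop where
  finite : FiniteDimensional ℚ K
  real : ∀ z ∈ F, conj z = z
  mem_iff : ∀ z, z ∈ K ↔ ∃ α ∈ F, ∃ β ∈ F, z = α + β * Complex.I
  totallyReal : ∀ (φ : K →+* ℂ) (x : K), (x : ℂ) ∈ F → conj (φ x) = φ x

lemma isGaussianExtension_biquadraticField (m n : ℕ) : IsGaussianExtension (biquadraticField m n)
    (biquadraticField m n ⊔ IntermediateField.adjoin ℚ {Complex.I}) := by
  have hmem (z : ℂ) : z ∈ biquadraticField m n ⊔ IntermediateField.adjoin ℚ {Complex.I} ↔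
      ∃ α ∈ biquadraticField m n, ∃ β ∈ biquadraticField m n, z = α + β * Complex.I :=
    mem_sup_adjoin_iff (by rw [Complex.I_sq]; exact neg_mem (one_mem _))
  have hint (d : ℕ) : IsIntegral ℚ ((√(d : ℝ) : ℝ) : ℂ) :=
    .of_pow two_pos (by
      rw [sqrt_natCast_sq]
      simpa using isIntegral_algebraMap (R := ℚ) (A := ℂ) (x := (d : ℚ)))
  refine ⟨?_, fun z hz ↦ conj_eq_of_mem_biquadraticField hz, hmem, fun φ x hx ↦ ?_⟩
  · have h1 : FiniteDimensional ℚ (IntermediateField.adjoin ℚ {Complex.I}) :=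
      IntermediateField.adjoin.finiteDimensional
        (.of_pow two_pos (by rw [Complex.I_sq]; exact isIntegral_one.neg))
    have h2 (d : ℕ) : FiniteDimensional ℚ (quadraticField d) :=
      IntermediateField.adjoin.finiteDimensional (hint d)
    have h3 : FiniteDimensional ℚ (biquadraticField m n) := by
      rw [biquadraticField_eq_sup]
      exact IntermediateField.finiteDimensional_sup _ _
    exact IntermediateField.finiteDimensional_sup _ _
  · obtain ⟨r, s, t, u, h⟩ := exists_coords_of_mem_biquadraticField hx
    have hsub {d : ℕ} (hd : ((√(d : ℝ) : ℝ) : ℂ) ∈ biquadraticField m n) :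
        ((√(d : ℝ) : ℝ) : ℂ) ∈ biquadraticField m n ⊔ IntermediateField.adjoin ℚ {Complex.I} :=
      le_sup_left (a := biquadraticField m n) hd
    have hm : ((√(m : ℝ) : ℝ) : ℂ) ∈ biquadraticField m n := by
      rw [biquadraticField_eq_sup]
      exact le_sup_left (a := quadraticField m) (sqrt_mem_quadraticField m)
    have hn : ((√(n : ℝ) : ℝ) : ℂ) ∈ biquadraticField m n := by
      rw [biquadraticField_eq_sup]
      exact le_sup_right (a := quadraticField m) (sqrt_mem_quadraticField n)
    have hx' : x = r + s * ⟨_, hsub hm⟩ + t * ⟨_, hsub hn⟩ +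
        u * (⟨_, hsub hm⟩ * ⟨_, hsub hn⟩) := Subtype.ext (by push_cast; exact h)
    have hconj {d : ℕ} (hd : ((√(d : ℝ) : ℝ) : ℂ) ∈ biquadraticField m n) :
        conj (φ ⟨_, hsub hd⟩) = φ ⟨_, hsub hd⟩ := by
      -- Every embedding sends √d to ±√d, which is real.
      have h1 : φ ⟨_, hsub hd⟩ ^ 2 = ((√(d : ℝ) : ℝ) : ℂ) ^ 2 := by
        rw [← map_pow, sqrt_natCast_sq, ← map_natCast φ]
        congr 1
        exact Subtype.ext (by push_cast; exact sqrt_natCast_sq d)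
      rcases sq_eq_sq_iff_eq_or_eq_neg.1 h1 with h1 | h1 <;> rw [h1] <;> simp
    rw [hx']
    simp only [map_add, map_mul, map_ratCast, hconj hm, hconj hn]

namespace IsGaussianExtension

variable {F K : IntermediateField ℚ ℂ}

lemma le (h : IsGaussianExtension F K) : F ≤ K :=
  fun z hz ↦ (h.mem_iff z).2 ⟨z, hz, 0, zero_mem F, by simp⟩

lemma I_mem (h : IsGaussianExtension F K) : Complex.I ∈ K :=
  (h.mem_iff _).2 ⟨0, zero_mem F, 1, one_mem F, by simp⟩

lemma conj_mem (h : IsGaussianExtension F K) {z : ℂ} (hz : z ∈ K) : conj z ∈ K := by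
  obtain ⟨α, hα, β, hβ, rfl⟩ := (h.mem_iff z).1 hz
  refine (h.mem_iff _).2 ⟨α, hα, -β, neg_mem hβ, ?_⟩
  simp [h.real α hα, h.real β hβ]

lemma mem_of_conj_eq (h : IsGaussianExtension F K) {z : ℂ} (hz : z ∈ K) (hc : conj z = z) :
    z ∈ F := by
  obtain ⟨α, hα, β, hβ, rfl⟩ := (h.mem_iff z).1 hz
  have h1 : conj (α + β * Complex.I) = α - β * Complex.I := by
    simp [h.real α hα, h.real β hβ]; ring
  rw [h1] at hc
  have h2 : β * Complex.I = 0 := by linear_combination (-1 / 2 : ℂ) * hc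
  rw [h2, add_zero]
  exact hα

lemma mem_maximalRealSubfield_iff (h : IsGaussianExtension F K) (x : K) :
    x ∈ maximalRealSubfield K ↔ (x : ℂ) ∈ F := by
  rw [NumberField.mem_maximalRealSubfield_iff]
  exact ⟨fun hx ↦ h.mem_of_conj_eq x.2 (hx (algebraMap K ℂ)), fun hx φ ↦ h.totallyReal φ x hx⟩

lemma map_maximalRealSubfield (h : IsGaussianExtension F K) :
    (maximalRealSubfield K).map (algebraMap K ℂ) = F.toSubfield := by
  ext z
  rw [Subfield.mem_map]
  constructor
  · rintro ⟨x, hx, rfl⟩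
    exact (h.mem_maximalRealSubfield_iff x).1 hx
  · intro hz
    exact ⟨⟨z, h.le hz⟩, (h.mem_maximalRealSubfield_iff _).2 hz, rfl⟩

lemma numberField (h : IsGaussianExtension F K) : NumberField K where
  to_finiteDimensional := h.finite

/-- A real embedding would send i to a real square root of -1, and 1, i is a basis over the maximal
real subfield. -/
lemma isCMField (h : IsGaussianExtension F K) : IsCMField K := by
  have := h.numberField
  let i : K := ⟨Complex.I, h.I_mem⟩
  have hi : i ^ 2 = -1 := Subtype.ext (by simp [i])
  have htc : IsTotallyComplex K := ⟨fun w ↦ by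
    rw [← InfinitePlace.not_isReal_iff_isComplex]
    intro hw
    have h1 := InfinitePlace.isReal_iff.1 hw
    have h2 : conj (w.embedding i) = w.embedding i := RingHom.congr_fun h1 i
    have h3 : w.embedding i ^ 2 = -1 := by rw [← map_pow, hi, map_neg, map_one]
    obtain ⟨r, hr⟩ := Complex.conj_eq_iff_real.1 h2
    rw [hr] at h3
    have h4 : r ^ 2 = -1 := by exact_mod_cast h3
    nlinarith⟩
  have hli : LinearIndependent (maximalRealSubfield K) ![(1 : K), i] := by
    rw [LinearIndependent.pair_iff]
    intro s t hst
    have hs : conj ((s : K) : ℂ) = (s : K) := h.real _ ((h.mem_maximalRealSubfield_iff _).1 s.2)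
    have ht : conj ((t : K) : ℂ) = (t : K) := h.real _ ((h.mem_maximalRealSubfield_iff _).1 t.2)
    have h1 : (((s : K) : ℂ)) + ((t : K) : ℂ) * Complex.I = 0 := by
      have := congrArg (algebraMap K ℂ) hst
      simpa [Subfield.smul_def, i] using this
    have h2 := congrArg conj h1
    simp only [map_add, map_mul, hs, ht, Complex.conj_I, map_zero] at h2
    have h3 : ((s : K) : ℂ) = 0 := by linear_combination (1 / 2 : ℂ) * (h1 + h2)
    have h4 : ((t : K) : ℂ) = 0 := by
      rw [h3, zero_add] at h1
      simpa using h1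
    exact ⟨Subtype.ext (Subtype.ext h3), Subtype.ext (Subtype.ext h4)⟩
  have hsp : ⊤ ≤ Submodule.span (maximalRealSubfield K) (Set.range ![(1 : K), i]) := by
    rintro x -
    rw [Matrix.range_cons, Matrix.range_cons, Matrix.range_empty, Set.union_empty,
      Set.singleton_union, Submodule.mem_span_pair]
    obtain ⟨α, hα, β, hβ, hx⟩ := (h.mem_iff x).1 x.2
    refine ⟨⟨⟨α, h.le hα⟩, (h.mem_maximalRealSubfield_iff _).2 hα⟩,
      ⟨⟨β, h.le hβ⟩, (h.mem_maximalRealSubfield_iff _).2 hβ⟩, Subtype.ext ?_⟩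
    rw [hx]
    simp [Subfield.smul_def, i]
  have hq : Algebra.IsQuadraticExtension (maximalRealSubfield K) K :=
    { finrank_eq_two' := by
        rw [Module.finrank_eq_card_basis (Module.Basis.mk hli hsp), Fintype.card_fin] }
  exact {}

/-- `u / ū` is a root of unity. -/
lemma div_conj_pow_eq_one (h : IsGaussianExtension F K) {u : ℂ} (hu : IsUnitOf K u) :
    ∃ n : ℕ, 0 < n ∧ (u / conj u) ^ n = 1 := by
  have := h.numberField
  have := h.isCMField
  obtain ⟨x, rfl⟩ := hu.exists_units
  obtain ⟨n, hn, h1⟩ := torsion_pow_eq_one (IsCMField.unitsMulComplexConjInv K x)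
  refine ⟨n, hn, ?_⟩
  rw [← h1, IsCMField.unitsMulComplexConjInv_apply, coe_units_mul, div_eq_mul_inv]
  congr 2
  have h2 := IsCMField.complexEmbedding_complexConj K (algebraMap K ℂ) ((x : 𝓞 K) : K)
  have h3 : ((((IsCMField.unitsComplexConj K x : (𝓞 K)ˣ) : 𝓞 K) : K) : ℂ) =
    conj (((x : 𝓞 K) : K) : ℂ) := h2
  rw [← h3, ← unitsToComplex_apply, ← unitsToComplex_apply, map_inv, Units.val_inv_eq_inv_val]

lemma mem_realUnits_iff (h : IsGaussianExtension F K) (x : (𝓞 K)ˣ) :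
    x ∈ IsCMField.realUnits K ↔ (((x : 𝓞 K) : K) : ℂ) ∈ F := by
  have := h.numberField
  have := h.isCMField
  rw [← IsCMField.unitsComplexConj_eq_self_iff]
  have h2 := IsCMField.complexEmbedding_complexConj K (algebraMap K ℂ) ((x : 𝓞 K) : K)
  have h3 : ((((IsCMField.unitsComplexConj K x : (𝓞 K)ˣ) : 𝓞 K) : K) : ℂ) =
    conj (((x : 𝓞 K) : K) : ℂ) := h2
  constructor
  · intro hx
    rw [hx] at h3
    exact h.mem_of_conj_eq ((x : 𝓞 K) : K).2 h3.symm
  · intro hx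
    exact units_coe_injective (h3.trans (h.real _ hx))

lemma mem_realUnits_sup_torsion_iff (h : IsGaussianExtension F K) (x : (𝓞 K)ˣ) :
    x ∈ IsCMField.realUnits K ⊔ Units.torsion K ↔ ∃ (n : ℕ) (ζ v : ℂ), 0 < n ∧ ζ ^ n = 1 ∧
      IsUnitOf F v ∧ (((x : 𝓞 K) : K) : ℂ) = ζ * v := by
  rw [Subgroup.mem_sup]
  constructor
  · rintro ⟨y, hy, z, hz, rfl⟩
    obtain ⟨n, hn, h1⟩ := torsion_pow_eq_one ⟨z, hz⟩
    exact ⟨n, _, _, hn, h1, (IsUnitOf.of_units y).of_mem ((h.mem_realUnits_iff y).1 hy),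
      by rw [coe_units_mul, mul_comm]⟩
  · rintro ⟨n, ζ, v, hn, hζ, hv, hx⟩
    obtain ⟨y, hy⟩ := (hv.mono h.le).exists_units
    have hζ' : ζ = (((x : 𝓞 K) : K) : ℂ) / v := by rw [hx]; field_simp [hv.ne_zero]
    obtain ⟨z, hz⟩ := ((IsUnitOf.of_units x).div (hv.mono h.le)).exists_units
    rw [← hζ'] at hz
    refine ⟨y, (h.mem_realUnits_iff y).2 (by rw [hy]; exact hv.1), z,
      mem_torsion_of_pow_eq_one z hn (by rw [hz, hζ]), units_coe_injective ?_⟩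
    rw [coe_units_mul, hy, hz, hx, mul_comm]

lemma indexRealUnits_eq_one (h : IsGaussianExtension F K)
    (hdec : ∀ u, IsUnitOf K u → ∃ (n : ℕ) (ζ v : ℂ), 0 < n ∧ ζ ^ n = 1 ∧ IsUnitOf F v ∧
      u = ζ * v) : IsCMField.indexRealUnits K = 1 := by
  rw [Subgroup.index_eq_one, eq_top_iff]
  exact fun x _ ↦ (h.mem_realUnits_sup_torsion_iff x).2 (hdec _ (.of_units x))

lemma indexRealUnits_eq_two (h : IsGaussianExtension F K) {s : ℂ} (hs : IsUnitOf K s)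
    (hdec : ¬ ∃ (n : ℕ) (ζ v : ℂ), 0 < n ∧ ζ ^ n = 1 ∧ IsUnitOf F v ∧ s = ζ * v) :
    IsCMField.indexRealUnits K = 2 := by
  have := h.numberField
  have := h.isCMField
  refine (IsCMField.indexRealUnits_eq_one_or_two K).resolve_left fun h1 ↦ hdec ?_
  obtain ⟨x, rfl⟩ := hs.exists_units
  rw [← h.mem_realUnits_sup_torsion_iff, Subgroup.index_eq_one.1 h1]
  trivial

end IsGaussianExtension

/-! ### Roots of unity and units of F(i). -/

lemma conj_eq_inv_of_pow_eq_one {ζ : ℂ} {n : ℕ} (hn : 0 < n) (h : ζ ^ n = 1) : conj ζ = ζ⁻¹ := by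
  have h1 := Complex.norm_eq_one_of_pow_eq_one h hn.ne'
  rw [Complex.inv_def, Complex.normSq_eq_norm_sq, h1]
  simp

namespace IsGaussianExtension

variable {F K : IntermediateField ℚ ℂ}

/-- For a primitive 8th root of unity ξ, the number ξ + ξ⁻¹ is real with square 2. -/
lemma pow_four_ne_neg_one (h : IsGaussianExtension F K) (h2 : ∀ z ∈ F, z ^ 2 ≠ 2) {ξ : ℂ}
    (hξ : ξ ∈ K) : ξ ^ 4 ≠ -1 := by
  intro h4
  have h8 : ξ ^ 8 = 1 := by
    rw [show ξ ^ 8 = (ξ ^ 4) ^ 2 by ring, h4]; norm_num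
  have h0 : ξ ≠ 0 := by rintro rfl; norm_num at h8
  have hc := conj_eq_inv_of_pow_eq_one (by norm_num) h8
  refine h2 (ξ + ξ⁻¹) (h.mem_of_conj_eq (add_mem hξ (inv_mem hξ)) ?_) ?_
  · rw [map_add, map_inv₀, hc, inv_inv, add_comm]
  · field_simp
    linear_combination h4

lemma pow_four_eq_one (h : IsGaussianExtension F K) (h2 : ∀ z ∈ F, z ^ 2 ≠ 2) (k : ℕ) :
    ∀ {ξ : ℂ}, ξ ∈ K → ξ ^ 2 ^ k = 1 → ξ ^ 4 = 1 := by
  induction k with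
  | zero => intro ξ _ h1; simp at h1; simp [h1]
  | succ k ih =>
    intro ξ hξ h1
    have h8 : (ξ ^ 2) ^ 4 = 1 := ih (pow_mem hξ 2) (by rw [← pow_mul, ← pow_succ', h1])
    have h4 : (ξ ^ 4) ^ 2 = 1 := by rw [← h8]; ring
    exact (mul_self_eq_one_iff.1 (by rw [← sq, h4])).resolve_right (h.pow_four_ne_neg_one h2 hξ)

/-- A root of unity of `K` is, up to squares of roots of unity, equal to `1` or `i`. -/
lemma eq_sq_or_eq_I_mul_sq (h : IsGaussianExtension F K) (h2 : ∀ z ∈ F, z ^ 2 ≠ 2) {ζ : ℂ}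
    (hζ : ζ ∈ K) {n : ℕ} (hn : 0 < n) (hpow : ζ ^ n = 1) :
    ∃ η ∈ K, ∃ m : ℕ, 0 < m ∧ η ^ m = 1 ∧ (ζ = η ^ 2 ∨ ζ = Complex.I * η ^ 2) := by
  -- With n = 2^k(2l + 1), ξ = ζ^(2l+1) has 2-power order, so it is a 4th root of unity, and ζξ =
  -- (ζ^(l+1))². Thus ζ is 1/ξ up to a square, and -1 = i² is a square.
  obtain ⟨k, m, ⟨l, rfl⟩, rfl⟩ := Nat.exists_eq_two_pow_mul_odd hn.ne'
  have hζ0 : ζ ≠ 0 := by rintro rfl; simp at hpow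
  have h4 := h.pow_four_eq_one h2 k (pow_mem hζ (2 * l + 1)) (by rw [← pow_mul, mul_comm, hpow])
  have hθ : ζ * ζ ^ (2 * l + 1) = (ζ ^ (l + 1)) ^ 2 := by ring
  have hθn : (ζ ^ (l + 1)) ^ (4 * (2 ^ k * (2 * l + 1))) = 1 := by
    rw [← pow_mul, show (l + 1) * (4 * (2 ^ k * (2 * l + 1))) =
      (2 ^ k * (2 * l + 1)) * (4 * (l + 1)) by ring, pow_mul, hpow, one_pow]
  have hIθn : (Complex.I * ζ ^ (l + 1)) ^ (4 * (2 ^ k * (2 * l + 1))) = 1 := by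
    rw [mul_pow, hθn, pow_mul, Complex.I_pow_four]; simp
  have hθK : ζ ^ (l + 1) ∈ K := pow_mem hζ _
  have hIθK : Complex.I * ζ ^ (l + 1) ∈ K := mul_mem h.I_mem hθK
  have hI := Complex.I_sq
  generalize ζ ^ (2 * l + 1) = ξ at h4 hθ
  generalize ζ ^ (l + 1) = θ at *
  have hcases : (ξ - 1) * ((ξ + 1) * ((ξ - Complex.I) * (ξ + Complex.I))) = 0 := by
    linear_combination h4 - (ξ ^ 2 - 1) * hI
  rcases mul_eq_zero.1 hcases with h1 | h1
  · exact ⟨θ, hθK, _, by omega, hθn, .inl (by linear_combination hθ - ζ * h1)⟩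
  rcases mul_eq_zero.1 h1 with h1 | h1
  · exact ⟨_, hIθK, _, by omega, hIθn, .inl (by linear_combination -hθ + ζ * h1 - θ ^ 2 * hI)⟩
  rcases mul_eq_zero.1 h1 with h1 | h1
  · exact ⟨_, hIθK, _, by omega, hIθn, .inr (by
      linear_combination -Complex.I * hθ + Complex.I * ζ * h1 + (ζ - Complex.I * θ ^ 2) * hI)⟩
  · exact ⟨θ, hθK, _, by omega, hθn, .inr (by
      linear_combination Complex.I * hθ - Complex.I * ζ * h1 + ζ * hI)⟩

/-- A unit of `K` is, up to a root of unity, either a unit of `F` or of argument `π/4` mod `π`. -/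
lemma unit_dichotomy (h : IsGaussianExtension F K) (h2 : ∀ z ∈ F, z ^ 2 ≠ 2) {u : ℂ}
    (hu : IsUnitOf K u) : ∃ (n : ℕ) (ζ v : ℂ), 0 < n ∧ ζ ^ n = 1 ∧ u = ζ * v ∧
      (IsUnitOf F v ∨ (IsUnitOf K v ∧ v = Complex.I * conj v)) := by
  obtain ⟨n, hn, hpow⟩ := h.div_conj_pow_eq_one hu
  have hc0 : conj u ≠ 0 := by simpa using hu.ne_zero
  obtain ⟨η, hηK, m, hm, hη, hcase⟩ :=
    h.eq_sq_or_eq_I_mul_sq h2 (div_mem hu.1 (h.conj_mem hu.1)) hn hpow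
  have hηU := IsUnitOf.of_pow_eq_one hηK hm hη
  have hη0 := hηU.ne_zero
  have hηc := conj_eq_inv_of_pow_eq_one hm hη
  refine ⟨m, η, u / η, hm, hη, by field_simp, ?_⟩
  -- Dividing by η divides u/ū by η², leaving the ratio 1 or i.
  have hc : conj (u / η) = conj u * η := by rw [map_div₀, hηc, div_inv_eq_mul]
  rcases hcase with h1 | h1
  · left
    refine (hu.div hηU).of_mem (h.mem_of_conj_eq (hu.div hηU).1 ?_)
    rw [hc]
    field_simp at h1 ⊢
    linear_combination -h1
  · right
    refine ⟨hu.div hηU, ?_⟩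
    rw [hc]
    field_simp at h1 ⊢
    linear_combination h1

/-- If `2v` is not a square in `F` for any unit `v` of `F`, then every unit of `K` is a root of unity
times a unit of `F`. -/
lemma unit_eq_mul_of_not_sq (h : IsGaussianExtension F K) (h2 : ∀ z ∈ F, z ^ 2 ≠ 2)
    (hno : ∀ w ∈ F, ∀ v, IsUnitOf F v → w ^ 2 ≠ 2 * v) {u : ℂ} (hu : IsUnitOf K u) :
    ∃ (n : ℕ) (ζ v : ℂ), 0 < n ∧ ζ ^ n = 1 ∧ IsUnitOf F v ∧ u = ζ * v := by
  obtain ⟨n, ζ, v, hn, hζ, rfl, hv | ⟨hv, hvc⟩⟩ := h.unit_dichotomy h2 hu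
  · exact ⟨n, ζ, v, hn, hζ, hv, rfl⟩
  exfalso
  have hcc : conj v = -Complex.I * v := by
    linear_combination Complex.I * hvc + conj v * Complex.I_sq
  -- An element with v = i·v̄ has argument π/4 mod π; multiplying by 1 - i makes it real, with
  -- square 2·v·v̄, which contradicts `hno`.
  have hw : v * (1 - Complex.I) ∈ F := by
    refine h.mem_of_conj_eq (mul_mem hv.1 (sub_mem (one_mem K) h.I_mem)) ?_
    rw [map_mul, map_sub, map_one, Complex.conj_I, hcc]
    linear_combination -v * Complex.I_sq
  have hn' : IsUnitOf F (v * conj v) := by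
    refine (hv.mul (hv.map_conj (h.conj_mem hv.1))).of_mem
      (h.mem_of_conj_eq (mul_mem hv.1 (h.conj_mem hv.1)) ?_)
    rw [map_mul, Complex.conj_conj, mul_comm]
  refine hno _ hw _ hn' ?_
  rw [hcc]
  linear_combination v ^ 2 * Complex.I_sq

/-- Compare s² = it with s·s̄ = |s|² = t and cancel s. -/
lemma eq_I_mul_conj {s : ℂ} {t : ℝ} (ht : 0 < t) (hs : s ^ 2 = Complex.I * t) :
    s = Complex.I * conj s := by
  have hn : ‖s‖ ^ 2 = t := by
    have := congrArg norm hs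
    rw [norm_pow, norm_mul, Complex.norm_I, one_mul, Complex.norm_real, Real.norm_of_nonneg ht.le]
      at this
    exact this
  have h0 : s ≠ 0 := by
    rintro rfl
    simp at hn
    linarith
  have h1 : s * conj s = t := by
    rw [Complex.mul_conj, Complex.normSq_eq_norm_sq, hn]
  apply mul_left_cancel₀ h0
  linear_combination hs - Complex.I * h1

/-- If s = ζv with v real, then i = s/s̄ = ζ², so ζ would be a primitive 8th root of unity in K. -/
lemma not_eq_mul_of_eq_I_mul_conj (h : IsGaussianExtension F K) (h2 : ∀ z ∈ F, z ^ 2 ≠ 2) {s : ℂ}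
    (hs : IsUnitOf K s) (hsc : s = Complex.I * conj s) :
    ¬ ∃ (n : ℕ) (ζ v : ℂ), 0 < n ∧ ζ ^ n = 1 ∧ IsUnitOf F v ∧ s = ζ * v := by
  rintro ⟨n, ζ, v, hn, hζ, hv, rfl⟩
  have hv0 := hv.ne_zero
  have hζ0 : ζ ≠ 0 := by rintro rfl; simp [hn.ne'] at hζ
  have hζK : ζ ∈ K := by
    have : ζ = ζ * v / v := by field_simp
    rw [this]
    exact div_mem hs.1 (h.le hv.1)
  rw [map_mul, conj_eq_inv_of_pow_eq_one hn hζ, h.real v hv.1] at hsc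
  apply h.pow_four_ne_neg_one h2 hζK
  field_simp at hsc
  rw [show ζ ^ 4 = (ζ ^ 2) ^ 2 by ring, hsc, Complex.I_sq]

/-- If `s ∈ K` has argument `π/4`, it generates the units of `K` over those of `F` and the roots of
unity. -/
lemma unit_eq_mul_zpow (h : IsGaussianExtension F K) (h2 : ∀ z ∈ F, z ^ 2 ≠ 2) {s : ℂ}
    (hs : IsUnitOf K s) (hsc : s = Complex.I * conj s) {u : ℂ} (hu : IsUnitOf K u) :
    ∃ (n : ℕ) (ζ v : ℂ) (k : ℤ), 0 < n ∧ ζ ^ n = 1 ∧ IsUnitOf F v ∧ u = ζ * v * s ^ k := by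
  obtain ⟨n, ζ, v, hn, hζ, rfl, hv | ⟨hv, hvc⟩⟩ := h.unit_dichotomy h2 hu
  · exact ⟨n, ζ, v, 0, hn, hζ, hv, by simp⟩
  · have hs0 := hs.ne_zero
    have hcs0 : conj s ≠ 0 := by simpa using hs0
    -- Both v and s satisfy z = i·z̄, so their quotient is real.
    refine ⟨n, ζ, v / s, 1, hn, hζ, (hv.div hs).of_mem (h.mem_of_conj_eq (hv.div hs).1 ?_), by
      rw [zpow_one]; field_simp⟩
    rw [map_div₀, div_eq_div_iff hcs0 hs0]
    linear_combination conj v * hsc - conj s * hvc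

end IsGaussianExtension

/-! ### Fundamental systems of F and of F(i). -/

/-- Three multiplicatively independent positive real units of `F`. -/
structure IsIndepUnits (F : IntermediateField ℚ ℂ) (ε₁ ε₂ ε₃ : ℝ) : Prop where
  pos₁ : 0 < ε₁
  pos₂ : 0 < ε₂
  pos₃ : 0 < ε₃
  unit₁ : IsUnitOf F ε₁
  unit₂ : IsUnitOf F ε₂
  unit₃ : IsUnitOf F ε₃
  indep : ∀ a b c : ℤ, ε₁ ^ a * ε₂ ^ b * ε₃ ^ c = 1 → a = 0 ∧ b = 0 ∧ c = 0

lemma prod_fin_three_zpow (v₁ v₂ v₃ : ℂ) (k : Fin 3 → ℤ) :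
    ∏ i, ![v₁, v₂, v₃] i ^ k i = v₁ ^ k 0 * v₂ ^ k 1 * v₃ ^ k 2 := by
  simp [Fin.prod_univ_three]

namespace IsIndepUnits

variable {F K : IntermediateField ℚ ℂ} {ε₁ ε₂ ε₃ : ℝ}

/-- Squared absolute values turn the relation into one among the εⱼ, with a triangular exponent
matrix of diagonal 2, i, l. -/
lemma eq_zero_of_norm_eq_one (H : IsIndepUnits F ε₁ ε₂ ε₃) {v₂ v₃ : ℂ} {i j l : ℤ}
    (h₂ : ‖v₂‖ ^ 2 = ε₂ ^ i) (h₃ : ‖v₃‖ ^ 2 = ε₂ ^ j * ε₃ ^ l) (hi : i ≠ 0) (hl : l ≠ 0)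
    (k : Fin 3 → ℤ) (hk : ‖∏ i, ![(ε₁ : ℂ), v₂, v₃] i ^ k i‖ = 1) : k = 0 := by
  have p₁ := H.pos₁
  have p₂ := H.pos₂
  have p₃ := H.pos₃
  rw [prod_fin_three_zpow, norm_mul, norm_mul, norm_zpow, norm_zpow, norm_zpow, Complex.norm_real,
    Real.norm_of_nonneg p₁.le] at hk
  have sq_zpow (x : ℝ) (n : ℤ) : (x ^ n) ^ 2 = (x ^ 2) ^ n := by
    rw [← zpow_natCast, ← zpow_mul, mul_comm, zpow_mul, zpow_natCast]
  have h := congrArg (· ^ 2) hk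
  simp only [mul_pow, sq_zpow, h₂, h₃, one_pow] at h
  have h' : ε₁ ^ (2 * k 0) * ε₂ ^ (i * k 1 + j * k 2) * ε₃ ^ (l * k 2) = 1 := by
    rw [← h, zpow_add₀ p₂.ne', zpow_mul, zpow_mul, zpow_mul, zpow_mul, mul_zpow]
    norm_cast
    ring
  obtain ⟨ha, hb, hc⟩ := H.indep _ _ _ h'
  have h2 : k 2 = 0 := (mul_eq_zero.1 hc).resolve_left hl
  have h0 : k 0 = 0 := by omega
  have h1 : k 1 = 0 := by
    rw [h2, mul_zero, add_zero] at hb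
    exact (mul_eq_zero.1 hb).resolve_left hi
  ext x
  fin_cases x
  · exact h0
  · exact h1
  · exact h2

lemma norm_snd_sq (H : IsIndepUnits F ε₁ ε₂ ε₃) : ‖(ε₂ : ℂ)‖ ^ 2 = ε₂ ^ (2 : ℤ) := by
  rw [Complex.norm_real, Real.norm_of_nonneg H.pos₂.le]; norm_cast

/-- Fundamental systems of `F`. -/
theorem isFSU_real (H : IsIndepUnits F ε₁ ε₂ ε₃) {η : ℂ} (hη : IsUnitOf F η) {j l : ℤ}
    (hηn : ‖η‖ ^ 2 = ε₂ ^ j * ε₃ ^ l) (hl : l ≠ 0)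
    (hgen : ∀ z, IsUnitOf F z → ∃ a b c : ℤ, z = ε₁ ^ a * ε₂ ^ b * η ^ c ∨
      z = -(ε₁ ^ a * ε₂ ^ b * η ^ c)) : IsFSU F ![(ε₁ : ℂ), ε₂, η] := by
  refine isFSU_of_generates ?_ (fun z hz ↦ ?_)
    (H.eq_zero_of_norm_eq_one H.norm_snd_sq hηn two_ne_zero hl)
  · intro i
    fin_cases i
    exacts [H.unit₁, H.unit₂, hη]
  · obtain ⟨a, b, c, h | h⟩ := hgen z hz
    · exact ⟨2, 1, ![a, b, c], two_pos, by norm_num, by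
        rw [prod_fin_three_zpow, h, one_mul]; rfl⟩
    · exact ⟨2, -1, ![a, b, c], two_pos, by norm_num, by
        rw [prod_fin_three_zpow, h, neg_one_mul]; rfl⟩

lemma generates_up_to_root {η : ℂ}
    (hgen : ∀ z, IsUnitOf F z → ∃ a b c : ℤ, z = ε₁ ^ a * ε₂ ^ b * η ^ c ∨
      z = -(ε₁ ^ a * ε₂ ^ b * η ^ c)) {n : ℕ} (hn : 0 < n) {ζ v : ℂ} (hζ : ζ ^ n = 1)
    (hv : IsUnitOf F v) : ∃ (m : ℕ) (ξ : ℂ) (a b c : ℤ), 0 < m ∧ ξ ^ m = 1 ∧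
      ζ * v = ξ * (ε₁ ^ a * ε₂ ^ b * η ^ c) := by
  obtain ⟨a, b, c, h | h⟩ := hgen v hv
  · exact ⟨n, ζ, a, b, c, hn, hζ, by rw [h]⟩
  · exact ⟨2 * n, -ζ, a, b, c, by omega, by rw [pow_mul, neg_sq, ← pow_mul, mul_comm, pow_mul, hζ,
      one_pow], by rw [h]; ring⟩

/-- Fundamental systems of `K` of unit index one. -/
theorem isFSU_of_index_one (H : IsIndepUnits F ε₁ ε₂ ε₃) (h : IsGaussianExtension F K)
    (h2 : ∀ z ∈ F, z ^ 2 ≠ 2) {η : ℂ} (hη : IsUnitOf F η) {j l : ℤ}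
    (hηn : ‖η‖ ^ 2 = ε₂ ^ j * ε₃ ^ l) (hl : l ≠ 0)
    (hgen : ∀ z, IsUnitOf F z → ∃ a b c : ℤ, z = ε₁ ^ a * ε₂ ^ b * η ^ c ∨
      z = -(ε₁ ^ a * ε₂ ^ b * η ^ c))
    (hno : ∀ w ∈ F, ∀ v, IsUnitOf F v → w ^ 2 ≠ 2 * v) :
    IsFSU K ![(ε₁ : ℂ), ε₂, η] ∧ IsCMField.indexRealUnits K = 1 := by
  refine ⟨isFSU_of_generates ?_ (fun z hz ↦ ?_)
    (H.eq_zero_of_norm_eq_one H.norm_snd_sq hηn two_ne_zero hl),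
    h.indexRealUnits_eq_one fun u hu ↦ h.unit_eq_mul_of_not_sq h2 hno hu⟩
  · intro i
    fin_cases i
    exacts [H.unit₁.mono h.le, H.unit₂.mono h.le, hη.mono h.le]
  · obtain ⟨n, ζ, v, hn, hζ, hv, rfl⟩ := h.unit_eq_mul_of_not_sq h2 hno hz
    obtain ⟨m, ξ, a, b, c, hm, hξ, hzv⟩ := generates_up_to_root hgen hn hζ hv
    exact ⟨m, ξ, ![a, b, c], hm, hξ, by rw [prod_fin_three_zpow, hzv]; rfl⟩

/-- Since ((1 + i)/2)² = i/2, a square root g of 2t yields the square root (1 + i)/2 · g of it. -/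
lemma _root_.IsGaussianExtension.mem_of_sq_eq_I_mul (h : IsGaussianExtension F K) {s t : ℂ}
    (hs : s ^ 2 = Complex.I * t) (ht : ∃ g ∈ F, g ^ 2 = 2 * t) : s ∈ K := by
  obtain ⟨g, hg, hgt⟩ := ht
  have hmem : (1 + Complex.I) / 2 * g ∈ K :=
    mul_mem (div_mem (add_mem (one_mem K) h.I_mem) (ofNat_mem K 2)) (h.le hg)
  have hsq : s ^ 2 = ((1 + Complex.I) / 2 * g) ^ 2 := by
    rw [hs]
    linear_combination (-(1 + Complex.I) ^ 2 / 4) * hgt - t / 2 * Complex.I_sq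
  rcases sq_eq_sq_iff_eq_or_eq_neg.1 hsq with h1 | h1 <;> rw [h1]
  · exact hmem
  · exact neg_mem hmem

lemma _root_.IsGaussianExtension.isUnitOf_of_sq_eq_I_mul (h : IsGaussianExtension F K) {s t : ℂ}
    (hs : s ^ 2 = Complex.I * t) (ht : ∃ g ∈ F, g ^ 2 = 2 * t) (htu : IsUnitOf F t) :
    IsUnitOf K s := by
  refine .of_sq (h.mem_of_sq_eq_I_mul hs ht) ?_
  rw [hs]
  exact (IsUnitOf.of_pow_eq_one h.I_mem (n := 4) (by norm_num) Complex.I_pow_four).mul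
    (htu.mono h.le)

lemma norm_sq_of_sq_eq_I_mul {s : ℂ} {t : ℝ} (ht : 0 ≤ t) (hs : s ^ 2 = Complex.I * t) :
    ‖s‖ ^ 2 = t := by
  have := congrArg norm hs
  rwa [norm_pow, norm_mul, Complex.norm_I, one_mul, Complex.norm_real, Real.norm_of_nonneg ht]
    at this

lemma inv_I_mul_pow {n : ℕ} {ξ : ℂ} (hξ : ξ ^ n = 1) (b : ℤ) :
    (ξ * (Complex.I ^ b)⁻¹) ^ (4 * n) = 1 := by
  have h4 : (Complex.I ^ b) ^ 4 = 1 := by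
    rw [← zpow_natCast, ← zpow_mul, mul_comm, zpow_mul, zpow_natCast, Complex.I_pow_four, one_zpow]
  rw [mul_pow, mul_comm 4 n, pow_mul, hξ, one_pow, one_mul, mul_comm n 4, pow_mul, inv_pow, h4,
    inv_one, one_pow]

/-- Fundamental systems of `K` containing `√(iε₂)`. -/
theorem isFSU_of_sqrt_I_mul_snd (H : IsIndepUnits F ε₁ ε₂ ε₃) (h : IsGaussianExtension F K)
    (h2 : ∀ z ∈ F, z ^ 2 ≠ 2) {η : ℂ} (hη : IsUnitOf F η) {j l : ℤ}
    (hηn : ‖η‖ ^ 2 = ε₂ ^ j * ε₃ ^ l) (hl : l ≠ 0)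
    (hgen : ∀ z, IsUnitOf F z → ∃ a b c : ℤ, z = ε₁ ^ a * ε₂ ^ b * η ^ c ∨
      z = -(ε₁ ^ a * ε₂ ^ b * η ^ c)) {s : ℂ} (hs : s ^ 2 = Complex.I * ε₂)
    (hg : ∃ g ∈ F, g ^ 2 = 2 * ε₂) :
    IsFSU K ![(ε₁ : ℂ), s, η] ∧ IsCMField.indexRealUnits K = 2 := by
  have hsu := h.isUnitOf_of_sq_eq_I_mul hs hg H.unit₂
  have hsc := IsGaussianExtension.eq_I_mul_conj H.pos₂ hs
  have hs0 := hsu.ne_zero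
  refine ⟨isFSU_of_generates ?_ (fun z hz ↦ ?_)
    (H.eq_zero_of_norm_eq_one (i := 1)
      (by rw [norm_sq_of_sq_eq_I_mul H.pos₂.le hs, zpow_one]) hηn one_ne_zero hl),
    h.indexRealUnits_eq_two hsu (h.not_eq_mul_of_eq_I_mul_conj h2 hsu hsc)⟩
  · intro i
    fin_cases i
    exacts [H.unit₁.mono h.le, hsu, hη.mono h.le]
  · obtain ⟨n, ζ, v, k, hn, hζ, hv, rfl⟩ := h.unit_eq_mul_zpow h2 hsu hsc hz
    obtain ⟨m, ξ, a, b, c, hm, hξ, hzv⟩ := generates_up_to_root hgen hn hζ hv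
    -- Substituting ε₂ = s²/i turns ε₂^b into s^(2b) and moves i^(-b) into the root of unity.
    refine ⟨4 * m, ξ * (Complex.I ^ b)⁻¹, ![a, 2 * b + k, c], by omega, inv_I_mul_pow hξ b, ?_⟩
    have hε : (ε₂ : ℂ) = Complex.I⁻¹ * s ^ (2 : ℤ) := by
      rw [show s ^ (2 : ℤ) = s ^ 2 by norm_cast, hs]; field_simp
    rw [prod_fin_three_zpow, hzv]
    change _ = ξ * (Complex.I ^ b)⁻¹ * ((ε₁ : ℂ) ^ a * s ^ (2 * b + k) * η ^ c)
    rw [hε, mul_zpow, ← zpow_mul, inv_zpow, zpow_add₀ hs0]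
    ring

/-- Fundamental systems of `K` containing `√(iε₃)` or `√(iε₂ε₃)`. -/
theorem isFSU_of_sqrt_I_mul_trd (H : IsIndepUnits F ε₁ ε₂ ε₃) (h : IsGaussianExtension F K)
    (h2 : ∀ z ∈ F, z ^ 2 ≠ 2)
    (hgen : ∀ z, IsUnitOf F z → ∃ a b c : ℤ, z = ε₁ ^ a * ε₂ ^ b * (ε₃ : ℂ) ^ c ∨
      z = -(ε₁ ^ a * ε₂ ^ b * (ε₃ : ℂ) ^ c)) {s : ℂ} {j : ℕ}
    (hs : s ^ 2 = Complex.I * (ε₂ ^ j * ε₃)) (hg : ∃ g ∈ F, g ^ 2 = 2 * ((ε₂ : ℂ) ^ j * ε₃)) :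
    IsFSU K ![(ε₁ : ℂ), ε₂, s] ∧ IsCMField.indexRealUnits K = 2 := by
  have p₂ := H.pos₂
  have p₃ := H.pos₃
  have ht : IsUnitOf F ((ε₂ : ℂ) ^ j * ε₃) := by
    have := prod_zpow_isUnitOf (F := F) (v := ![(ε₁ : ℂ), ε₂, ε₃])
      (fun i ↦ by fin_cases i; exacts [H.unit₁, H.unit₂, H.unit₃]) ![0, j, 1]
    rw [prod_fin_three_zpow] at this
    simpa using this
  have hs' : s ^ 2 = Complex.I * ((ε₂ ^ j * ε₃ : ℝ) : ℂ) := by rw [hs]; push_cast; rfl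
  have hsu := h.isUnitOf_of_sq_eq_I_mul hs hg ht
  have hsc := IsGaussianExtension.eq_I_mul_conj (by positivity) hs'
  have hs0 := hsu.ne_zero
  have hε₂ : (ε₂ : ℂ) ≠ 0 := H.unit₂.ne_zero
  refine ⟨isFSU_of_generates ?_ (fun z hz ↦ ?_)
    (H.eq_zero_of_norm_eq_one (j := j) (l := 1) H.norm_snd_sq
      (by rw [norm_sq_of_sq_eq_I_mul (by positivity) hs', zpow_one, zpow_natCast])
      two_ne_zero one_ne_zero),
    h.indexRealUnits_eq_two hsu (h.not_eq_mul_of_eq_I_mul_conj h2 hsu hsc)⟩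
  · intro i
    fin_cases i
    exacts [H.unit₁.mono h.le, H.unit₂.mono h.le, hsu]
  · obtain ⟨n, ζ, v, k, hn, hζ, hv, rfl⟩ := h.unit_eq_mul_zpow h2 hsu hsc hz
    obtain ⟨m, ξ, a, b, c, hm, hξ, hzv⟩ := generates_up_to_root hgen hn hζ hv
    -- Now ε₃ = s²/(i·ε₂^j) is eliminated, which also shifts the exponent of ε₂ by -jc.
    refine ⟨4 * m, ξ * (Complex.I ^ c)⁻¹, ![a, b - j * c, 2 * c + k], by omega,
      inv_I_mul_pow hξ c, ?_⟩
    have hε : (ε₃ : ℂ) = Complex.I⁻¹ * s ^ (2 : ℤ) * ((ε₂ : ℂ) ^ (j : ℤ))⁻¹ := by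
      rw [show s ^ (2 : ℤ) = s ^ 2 by norm_cast, hs, zpow_natCast]
      field_simp
    rw [prod_fin_three_zpow, hzv]
    change _ = ξ * (Complex.I ^ c)⁻¹ * ((ε₁ : ℂ) ^ a * ε₂ ^ (b - j * c) * s ^ (2 * c + k))
    rw [hε, mul_zpow, mul_zpow, ← zpow_mul, inv_zpow, inv_zpow, ← zpow_mul, zpow_add₀ hs0,
      zpow_sub₀ hε₂]
    ring

end IsIndepUnits

/-! ### From abstract units of F to the given real and complex numbers. -/

/-- Roots of unity of the real quadratic field are ±1, so a fundamental system generates up to sign.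
-/
lemma isQuadFundUnit_of_isFundamentalUnit {F : IntermediateField ℚ ℂ} {ι : F →+* ℝ} {φ : F →+* F}
    (hι : ∀ w : F, (w : ℂ) = (ι w : ℝ)) {d : ℕ} {g : F} (hg : (g : ℂ) = (√(d : ℝ) : ℝ))
    (hφ : φ g = -g) {ε : ℝ} (hε : IsFundamentalUnit d ε) {r s : ℚ}
    (hrs : ε = r + s * √(d : ℝ)) : IsQuadFundUnit ι φ d g r s := by
  obtain ⟨hε1, hF⟩ := hε
  have hcoe (r s : ℚ) : (((r + s * g : F)) : ℂ) = r + s * ((√(d : ℝ) : ℝ) : ℂ) := by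
    push_cast; rw [hg]
  have hεF : ((r + s * g : F) : ℂ) = (ε : ℂ) := by rw [hcoe, hrs]; push_cast; rfl
  refine ⟨Subtype.ext ?_, hφ, ?_, ?_, fun r' s' hu ↦ ?_⟩
  · push_cast; rw [hg, sqrt_natCast_sq]
  · have : ι (r + s * g) = ε := by
      have := hι (r + s * g)
      rw [hεF] at this
      exact_mod_cast this.symm
    rw [this]; exact hε1
  · apply IsIntegralUnit.of_map (algebraMap F ℂ)
    have := (hF.isUnitOf 0).2
    rw [show algebraMap F ℂ (r + s * g) = (ε : ℂ) from hεF]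
    exact this
  · have hu' : IsUnitOf (quadraticField d) ((r' + s' * g : F) : ℂ) :=
      ⟨by rw [hcoe]; exact mem_quadraticField_iff.2 ⟨r', s', rfl⟩, hu.map (algebraMap F ℂ)⟩
    obtain ⟨n, ζ, k, hn, hζ, hz⟩ := hF.generates hu'
    simp only [Finset.univ_unique, Fin.default_eq_zero, Fin.isValue, Matrix.cons_val_fin_one,
      Finset.prod_singleton] at hz
    have hε0 : (ε : ℂ) ≠ 0 := (hF.isUnitOf 0).ne_zero
    have hζr : conj ζ = ζ := by
      have h1 : ζ = ((r' + s' * g : F) : ℂ) / (ε : ℂ) ^ k 0 := by rw [hz]; field_simp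
      rw [h1, hι]
      simp
    have hpow : (((r + s * g : F) ^ k 0 : F) : ℂ) = (ε : ℂ) ^ k 0 := by
      rw [← hεF]; exact map_zpow₀ (algebraMap F ℂ) _ _
    refine ⟨k 0, ?_⟩
    rcases eq_one_or_neg_one_of_real_of_pow_eq_one hn hζ hζr with h1 | h1
    · left
      apply Subtype.ext
      rw [hz, h1, one_mul, hpow]
    · right
      apply Subtype.ext
      rw [hz, h1, neg_one_mul, IntermediateField.coe_neg, hpow]

namespace IsUnitTriple

variable {F K : IntermediateField ℚ ℂ} {σ τ : F →+* F} {ι : F →+* ℝ} {E₁ E₂ E₃ : F}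
  {ε₁ ε₂ ε₃ : ℝ}

/-- The units of a triple are integral, and equal to given real numbers. -/
structure Realizes (E₁ E₂ E₃ : F) (ε₁ ε₂ ε₃ : ℝ) : Prop where
  coe₁ : (E₁ : ℂ) = ε₁
  coe₂ : (E₂ : ℂ) = ε₂
  coe₃ : (E₃ : ℂ) = ε₃
  unit₁ : IsIntegralUnit E₁
  unit₂ : IsIntegralUnit E₂
  unit₃ : IsIntegralUnit E₃

lemma Realizes.isIndepUnits (R : Realizes E₁ E₂ E₃ ε₁ ε₂ ε₃) (T : IsUnitTriple σ τ ι E₁ E₂ E₃)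
    (hι : ∀ w : F, (w : ℂ) = (ι w : ℝ)) : IsIndepUnits F ε₁ ε₂ ε₃ := by
  have h₁ : ι E₁ = ε₁ := by exact_mod_cast (hι E₁).symm.trans R.coe₁
  have h₂ : ι E₂ = ε₂ := by exact_mod_cast (hι E₂).symm.trans R.coe₂
  have h₃ : ι E₃ = ε₃ := by exact_mod_cast (hι E₃).symm.trans R.coe₃
  exact
  { pos₁ := by linarith [T.fst_gt]
    pos₂ := by linarith [T.snd_gt]
    pos₃ := by linarith [T.trd_gt]
    unit₁ := by rw [← R.coe₁]; exact ⟨E₁.2, R.unit₁.map (algebraMap F ℂ)⟩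
    unit₂ := by rw [← R.coe₂]; exact ⟨E₂.2, R.unit₂.map (algebraMap F ℂ)⟩
    unit₃ := by rw [← R.coe₃]; exact ⟨E₃.2, R.unit₃.map (algebraMap F ℂ)⟩
    indep := fun a b c habc ↦ T.indep (by rw [h₁, h₂, h₃, habc]) }

lemma Realizes.generates (R : Realizes E₁ E₂ E₃ ε₁ ε₂ ε₃) {H : F} {η : ℂ} (hη : (H : ℂ) = η)
    (hgen : ∀ u : F, IsIntegralUnit u → ∃ a b c : ℤ, u = E₁ ^ a * E₂ ^ b * H ^ c ∨
      u = -(E₁ ^ a * E₂ ^ b * H ^ c)) (z : ℂ) (hz : IsUnitOf F z) :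
    ∃ a b c : ℤ, z = ε₁ ^ a * ε₂ ^ b * η ^ c ∨ z = -(ε₁ ^ a * ε₂ ^ b * η ^ c) := by
  obtain ⟨a, b, c, h⟩ := hgen ⟨z, hz.1⟩ (.of_map (algebraMap F ℂ) hz.2)
  refine ⟨a, b, c, h.imp (fun h ↦ ?_) (fun h ↦ ?_)⟩ <;>
  · have := congrArg (algebraMap F ℂ) h
    simp only [map_neg, map_mul, map_zpow₀] at this
    rw [← R.coe₁, ← R.coe₂, ← hη]
    exact this

lemma not_sq_of_not_isSquare {w : F} (hw : ¬ IsSquare w) : ∀ z ∈ F, z ^ 2 ≠ (w : ℂ) :=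
  fun z hz h ↦ hw ⟨⟨z, hz⟩, Subtype.ext (by push_cast; rw [← h, sq])⟩

lemma exists_sq_of_isSquare {w : F} (hw : IsSquare w) : ∃ g ∈ F, g ^ 2 = (w : ℂ) := by
  obtain ⟨g, rfl⟩ := hw
  exact ⟨g, g.2, by push_cast; ring⟩

lemma mem_of_sq_eq {w : F} (hw : IsSquare w) {r : ℂ} (hr : r ^ 2 = w) : r ∈ F := by
  obtain ⟨g, hg, hgw⟩ := exists_sq_of_isSquare hw
  rcases sq_eq_sq_iff_eq_or_eq_neg.1 (hr.trans hgw.symm) with h | h <;> rw [h]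
  · exact hg
  · exact neg_mem hg

lemma norm_sq_of_sq_eq {r : ℂ} {t : ℝ} (ht : 0 ≤ t) (hr : r ^ 2 = t) : ‖r‖ ^ 2 = t := by
  have := congrArg norm hr
  rwa [norm_pow, Complex.norm_real, Real.norm_of_nonneg ht] at this

/-- A third generator `η` of the units of `F`, after `ε₁` and `ε₂`. -/
structure IsThirdGenerator (F : IntermediateField ℚ ℂ) (ε₁ ε₂ ε₃ : ℝ) (η : ℂ) : Prop where
  isUnitOf : IsUnitOf F η
  norm_sq : ∃ j l : ℤ, l ≠ 0 ∧ ‖η‖ ^ 2 = ε₂ ^ j * ε₃ ^ l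
  generates : ∀ z, IsUnitOf F z → ∃ a b c : ℤ, z = ε₁ ^ a * ε₂ ^ b * η ^ c ∨
    z = -(ε₁ ^ a * ε₂ ^ b * η ^ c)

lemma Realizes.isThirdGenerator (R : Realizes E₁ E₂ E₃ ε₁ ε₂ ε₃)
    (T : IsUnitTriple σ τ ι E₁ E₂ E₃) (hι : ∀ w : F, (w : ℂ) = (ι w : ℝ)) (h₂ : ¬ IsSquare E₂)
    (h₃ : ¬ IsSquare E₃) (h₂₃ : ¬ IsSquare (E₂ * E₃)) : IsThirdGenerator F ε₁ ε₂ ε₃ ε₃ := by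
  have I := R.isIndepUnits T hι
  refine ⟨I.unit₃, ⟨0, 2, two_ne_zero, ?_⟩,
    R.generates R.coe₃ fun u hu ↦ T.exists_eq_of_not_isSquare h₂ h₃ h₂₃ hu⟩
  rw [Complex.norm_real, Real.norm_of_nonneg I.pos₃.le, zpow_zero, one_mul]
  norm_cast

lemma Realizes.isThirdGenerator_sqrt_mul (R : Realizes E₁ E₂ E₃ ε₁ ε₂ ε₃)
    (T : IsUnitTriple σ τ ι E₁ E₂ E₃) (hι : ∀ w : F, (w : ℂ) = (ι w : ℝ)) (h₂ : ¬ IsSquare E₂)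
    (h₃ : ¬ IsSquare E₃) (h₂₃ : IsSquare (E₂ * E₃)) {r : ℂ} (hr : r ^ 2 = ε₂ * ε₃) :
    IsThirdGenerator F ε₁ ε₂ ε₃ r := by
  have I := R.isIndepUnits T hι
  have p₂ := I.pos₂
  have p₃ := I.pos₃
  have hr' : r ^ 2 = ((E₂ * E₃ : F) : ℂ) := by push_cast; rw [hr, R.coe₂, R.coe₃]
  have hrF := mem_of_sq_eq h₂₃ hr'
  refine ⟨.of_sq hrF (by rw [hr]; exact I.unit₂.mul I.unit₃), ⟨1, 1, one_ne_zero, ?_⟩,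
    R.generates (H := ⟨r, hrF⟩) rfl fun u hu ↦
      T.exists_eq_of_sq_eq_mul h₂ h₃ (Subtype.ext (by push_cast; exact hr')) hu⟩
  rw [zpow_one, zpow_one]
  exact norm_sq_of_sq_eq (by positivity) (by rw [hr]; push_cast; rfl)

lemma Realizes.isThirdGenerator_sqrt (R : Realizes E₁ E₂ E₃ ε₁ ε₂ ε₃)
    (T : IsUnitTriple σ τ ι E₁ E₂ E₃) (hι : ∀ w : F, (w : ℂ) = (ι w : ℝ)) (h₂ : ¬ IsSquare E₂)
    (h₂₃ : ¬ IsSquare (E₂ * E₃)) (h₃ : IsSquare E₃) {r : ℂ} (hr : r ^ 2 = ε₃) :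
    IsThirdGenerator F ε₁ ε₂ ε₃ r := by
  have I := R.isIndepUnits T hι
  have hr' : r ^ 2 = (E₃ : ℂ) := by rw [hr, R.coe₃]
  have hrF := mem_of_sq_eq h₃ hr'
  refine ⟨.of_sq hrF (by rw [hr]; exact I.unit₃), ⟨0, 1, one_ne_zero, ?_⟩,
    R.generates (H := ⟨r, hrF⟩) rfl fun u hu ↦
      T.exists_eq_of_sq_eq h₂ h₂₃ (Subtype.ext (by push_cast; exact hr')) hu⟩
  rw [zpow_zero, zpow_one, one_mul]
  exact norm_sq_of_sq_eq I.pos₃.le hr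

lemma IsThirdGenerator.index_one {η : ℂ} (G : IsThirdGenerator F ε₁ ε₂ ε₃ η)
    (R : Realizes E₁ E₂ E₃ ε₁ ε₂ ε₃) (T : IsUnitTriple σ τ ι E₁ E₂ E₃)
    (hι : ∀ w : F, (w : ℂ) = (ι w : ℝ)) (hK : IsGaussianExtension F K) (h₀ : ¬ IsSquare (2 : F))
    (h₂ : ¬ IsSquare (2 * E₂)) (h₃ : ¬ IsSquare (2 * E₃)) (h₂₃ : ¬ IsSquare (2 * (E₂ * E₃))) :
    IsFSU F ![(ε₁ : ℂ), ε₂, η] ∧ IsFSU K ![(ε₁ : ℂ), ε₂, η] ∧ IsCMField.indexRealUnits K = 1 := by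
  have I := R.isIndepUnits T hι
  obtain ⟨j, l, hl, hn⟩ := G.norm_sq
  refine ⟨I.isFSU_real G.isUnitOf hn hl G.generates, I.isFSU_of_index_one hK
    (not_sq_of_not_isSquare h₀) G.isUnitOf hn hl G.generates fun w hw v hv h ↦ ?_⟩
  refine T.not_sq_eq_two_mul h₀ h₂ h₃ h₂₃ (w := ⟨w, hw⟩) (v := ⟨v, hv.1⟩)
    (.of_map (algebraMap F ℂ) hv.2) (Subtype.ext ?_)
  push_cast
  exact h

lemma IsThirdGenerator.index_two {η : ℂ} (G : IsThirdGenerator F ε₁ ε₂ ε₃ η)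
    (R : Realizes E₁ E₂ E₃ ε₁ ε₂ ε₃) (T : IsUnitTriple σ τ ι E₁ E₂ E₃)
    (hι : ∀ w : F, (w : ℂ) = (ι w : ℝ)) (hK : IsGaussianExtension F K) (h₀ : ¬ IsSquare (2 : F))
    (h₂ : IsSquare (2 * E₂)) {s : ℂ} (hs : s ^ 2 = Complex.I * ε₂) :
    IsFSU F ![(ε₁ : ℂ), ε₂, η] ∧ IsFSU K ![(ε₁ : ℂ), s, η] ∧ IsCMField.indexRealUnits K = 2 := by
  have I := R.isIndepUnits T hι
  obtain ⟨j, l, hl, hn⟩ := G.norm_sq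
  refine ⟨I.isFSU_real G.isUnitOf hn hl G.generates, I.isFSU_of_sqrt_I_mul_snd hK
    (not_sq_of_not_isSquare h₀) G.isUnitOf hn hl G.generates hs ?_⟩
  obtain ⟨g, hg, hgs⟩ := exists_sq_of_isSquare h₂
  exact ⟨g, hg, by rw [hgs]; push_cast; rw [R.coe₂]; rfl⟩

/-- Used with j = 0 for √(iε₃) and with j = 1 for √(iε₂ε₃). -/
lemma IsThirdGenerator.index_two' (G : IsThirdGenerator F ε₁ ε₂ ε₃ ε₃)
    (R : Realizes E₁ E₂ E₃ ε₁ ε₂ ε₃) (T : IsUnitTriple σ τ ι E₁ E₂ E₃)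
    (hι : ∀ w : F, (w : ℂ) = (ι w : ℝ)) (hK : IsGaussianExtension F K) (h₀ : ¬ IsSquare (2 : F))
    {j : ℕ} (h₃ : IsSquare (2 * (E₂ ^ j * E₃))) {s : ℂ}
    (hs : s ^ 2 = Complex.I * (ε₂ ^ j * ε₃)) :
    IsFSU F ![(ε₁ : ℂ), ε₂, (ε₃ : ℂ)] ∧ IsFSU K ![(ε₁ : ℂ), ε₂, s] ∧
      IsCMField.indexRealUnits K = 2 := by
  have I := R.isIndepUnits T hι
  obtain ⟨j', l, hl, hn⟩ := G.norm_sq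
  refine ⟨I.isFSU_real G.isUnitOf hn hl G.generates, I.isFSU_of_sqrt_I_mul_trd hK
    (not_sq_of_not_isSquare h₀) G.generates hs ?_⟩
  obtain ⟨g, hg, hgs⟩ := exists_sq_of_isSquare h₃
  exact ⟨g, hg, by rw [hgs]; push_cast; rw [R.coe₂, R.coe₃]; rfl⟩

end IsUnitTriple

/-! ### Square classes in ℚ(√p₁, √(p₂q)) and the seven cases. -/

/-- `2`, `p₂` and `2p₂` are not squares in `ℚ(√p₁, √(p₂q))`. -/
lemma BiquadraticData.not_isSquare_two_prime {L : Type*} [Field L] [CharZero L] {p₁ p₂ q : ℕ}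
    (D : BiquadraticData L p₁ (p₂ * q)) (hp₁ : p₁.Prime) (hp₂ : p₂.Prime) (hq : q.Prime)
    (hne : p₁ ≠ p₂) (hp₁4 : p₁ % 4 = 1) (hp₂4 : p₂ % 4 = 1) (hq4 : q % 4 = 3) :
    ¬ IsSquare (2 : L) ∧ ¬ IsSquare (p₂ : L) ∧ ¬ IsSquare (2 * p₂ : L) := by
  have o₁ : ¬ 2 ∣ p₁ := by omega
  have o₂ : ¬ 2 ∣ p₂ := by omega
  have o₃ : ¬ 2 ∣ q := by omega
  have h21 : ¬ p₂ ∣ p₁ := fun h ↦ hne ((Nat.prime_dvd_prime_iff_eq hp₂ hp₁).1 h).symm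
  have hq1 : ¬ q ∣ p₁ := fun h ↦ by
    have := (Nat.prime_dvd_prime_iff_eq hq hp₁).1 h; omega
  have hq2 : ¬ q ∣ p₂ := fun h ↦ by
    have := (Nat.prime_dvd_prime_iff_eq hq hp₂).1 h; omega
  have key (ℓ c k : ℕ) (hℓ : ℓ.Prime) (hk : ¬ ℓ ∣ k) (hc : c = ℓ * k) : ¬ IsSquare (c : ℚ) := by
    rw [hc]; exact Nat.not_isSquare_cast_of_dvd hℓ hk
  -- A rational nonsquare c stays a nonsquare in L if its products with p₁, p₂q and p₁p₂q are
  -- nonsquares too; in each of the twelve resulting numbers some prime occurs exactly once.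
  have main (c : ℕ) (h1 : ¬ IsSquare (c : ℚ)) (h2 : ¬ IsSquare ((c * p₁ : ℕ) : ℚ))
      (h3 : ¬ IsSquare ((c * (p₂ * q) : ℕ) : ℚ))
      (h4 : ¬ IsSquare ((c * (p₁ * (p₂ * q)) : ℕ) : ℚ)) : ¬ IsSquare (c : L) := by
    intro h
    push_cast at h2 h3 h4
    rcases D.isSquare_ratCast (q := c) (by simpa using h) with h | h | h | h <;>
      push_cast at h <;> contradiction
  have t := Nat.prime_two
  refine ⟨?_, ?_, ?_⟩
  · have := main 2 (key 2 _ 1 t (by norm_num) (by ring)) (key 2 _ p₁ t o₁ (by ring))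
      (key 2 _ (p₂ * q) t (by simp [t.dvd_mul, *]) (by ring))
      (key 2 _ (p₁ * (p₂ * q)) t (by simp [t.dvd_mul, *]) (by ring))
    exact_mod_cast this
  · exact main p₂ (key p₂ _ 1 hp₂ hp₂.not_dvd_one (by ring)) (key p₂ _ p₁ hp₂ h21 (by ring))
      (key q _ (p₂ * p₂) hq (by simp [hq.dvd_mul, *]) (by ring))
      (key q _ (p₁ * (p₂ * p₂)) hq (by simp [hq.dvd_mul, *]) (by ring))
  · have := main (2 * p₂) (key 2 _ p₂ t o₂ (by ring))
      (key 2 _ (p₂ * p₁) t (by simp [t.dvd_mul, *]) (by ring))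
      (key 2 _ (p₂ * (p₂ * q)) t (by simp [t.dvd_mul, *]) (by ring))
      (key 2 _ (p₂ * (p₁ * (p₂ * q))) t (by simp [t.dvd_mul, *]) (by ring))
    exact_mod_cast this

theorem proposition3p1 (p₁ p₂ q : ℕ) (hp₁ : p₁.Prime) (hp₂ : p₂.Prime) (hq : q.Prime)
    (hne : p₁ ≠ p₂) (hp₁4 : p₁ % 4 = 1) (hp₂4 : p₂ % 4 = 1) (hq4 : q % 4 = 3)
    -- the fundamental units of `ℚ(√p₁)`, `ℚ(√(p₂q))` and `ℚ(√(p₁p₂q))`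
    (ε₁ ε₂ ε₃ : ℝ) (hε₁ : IsFundamentalUnit p₁ ε₁) (hε₂ : IsFundamentalUnit (p₂ * q) ε₂)
    (hε₃ : IsFundamentalUnit (p₁ * p₂ * q) ε₃)
    (a b x y : ℚ) (hab : ε₂ = a + b * √((p₂ * q : ℕ) : ℝ))
    (hxy : ε₃ = x + y * √((p₁ * p₂ * q : ℕ) : ℝ))
    -- arbitrary choices of `√ε₃`, `√(ε₂ε₃)`, `√(iε₂)`, `√(iε₃)` and `√(iε₂ε₃)`
    (r₃ r₂₃ s₂ s₃ s₂₃ : ℂ) (hr₃ : r₃ ^ 2 = ε₃) (hr₂₃ : r₂₃ ^ 2 = ε₂ * ε₃)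
    (hs₂ : s₂ ^ 2 = Complex.I * ε₂) (hs₃ : s₃ ^ 2 = Complex.I * ε₃)
    (hs₂₃ : s₂₃ ^ 2 = Complex.I * (ε₂ * ε₃))
    -- the two fields
    (K Kplus : IntermediateField ℚ ℂ) (hK : K = fieldK1 p₁ p₂ q)
    (hKplus : Kplus = biquadraticField p₁ (p₂ * q)) :
    -- `K` is a CM-field with maximal real subfield `Kplus`
    (NumberField.IsCMField K ∧
      (NumberField.maximalRealSubfield K).map (algebraMap K ℂ) = Kplus.toSubfield) ∧
    -- 1.
    (PMSq 1 a ∧ (PMSq 1 x ∨ PMSq p₁ x) →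
      IsFSU Kplus ![(ε₁ : ℂ), ε₂, r₂₃] ∧ IsFSU K ![(ε₁ : ℂ), s₂, r₂₃] ∧
      NumberField.IsCMField.indexRealUnits K = 2) ∧
    -- 2.
    ((PMSq 1 x ∨ PMSq p₁ x) ∧ ¬ PMSq 1 a →
      IsFSU Kplus ![(ε₁ : ℂ), ε₂, ε₃] ∧ IsFSU K ![(ε₁ : ℂ), ε₂, s₃] ∧
      NumberField.IsCMField.indexRealUnits K = 2) ∧
    -- 3.
    (PMSq 1 a ∧ PMSq (2 * p₁) x →
      IsFSU Kplus ![(ε₁ : ℂ), ε₂, r₃] ∧ IsFSU K ![(ε₁ : ℂ), s₂, r₃] ∧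
      NumberField.IsCMField.indexRealUnits K = 2) ∧
    -- 4.
    (PMSq (2 * p₁) x ∧ ¬ PMSq 1 a →
      IsFSU Kplus ![(ε₁ : ℂ), ε₂, r₃] ∧ IsFSU K ![(ε₁ : ℂ), ε₂, r₃] ∧
      NumberField.IsCMField.indexRealUnits K = 1) ∧
    -- 5.
    ((PMSq 1 a ∧ (PMSq p₂ x ∨ PMSq (2 * p₂) x)) ∨ (PMSq 1 a ∧ (PMSq q x ∨ PMSq (2 * q) x)) →
      IsFSU Kplus ![(ε₁ : ℂ), ε₂, ε₃] ∧ IsFSU K ![(ε₁ : ℂ), s₂, ε₃] ∧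
      NumberField.IsCMField.indexRealUnits K = 2) ∧
    -- 6.
    ((PMSq p₂ a ∧ (PMSq p₂ x ∨ PMSq q x)) ∨
        (PMSq (2 * p₂) a ∧ (PMSq (2 * p₂) x ∨ PMSq (2 * q) x)) →
      IsFSU Kplus ![(ε₁ : ℂ), ε₂, r₂₃] ∧ IsFSU K ![(ε₁ : ℂ), ε₂, r₂₃] ∧
      NumberField.IsCMField.indexRealUnits K = 1) ∧
    -- 7.
    ((PMSq p₂ a ∧ (PMSq (2 * p₂) x ∨ PMSq (2 * q) x)) ∨
        (PMSq (2 * p₂) a ∧ (PMSq p₂ x ∨ PMSq q x)) →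
      IsFSU Kplus ![(ε₁ : ℂ), ε₂, ε₃] ∧ IsFSU K ![(ε₁ : ℂ), ε₂, s₂₃] ∧
      NumberField.IsCMField.indexRealUnits K = 2) := by
  subst hK hKplus
  rw [fieldK1_eq_sup hp₁.ne_zero]
  have hq1 : ¬ q ∣ p₁ := fun h ↦ by
    have := (Nat.prime_dvd_prime_iff_eq hq hp₁).1 h; omega
  have hq2 : ¬ q ∣ p₂ := fun h ↦ by
    have := (Nat.prime_dvd_prime_iff_eq hq hp₂).1 h; omega
  have hn0 : p₂ * q ≠ 0 := mul_ne_zero hp₂.ne_zero hq.ne_zero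
  have hmn0 : p₁ * (p₂ * q) ≠ 0 := mul_ne_zero hp₁.ne_zero hn0
  have hG := isGaussianExtension_biquadraticField p₁ (p₂ * q)
  refine ⟨⟨hG.isCMField, hG.map_maximalRealSubfield⟩, ?_⟩
  obtain ⟨D, he, hf, hι⟩ := exists_biquadraticData (m := p₁) (n := p₂ * q)
    (by simpa using Nat.not_isSquare_cast_of_dvd hp₁ hp₁.not_dvd_one)
    (by rw [mul_comm]; exact Nat.not_isSquare_cast_of_dvd hq hq2)
    (by
      rw [show p₁ * (p₂ * q) = q * (p₁ * p₂) by ring]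
      exact Nat.not_isSquare_cast_of_dvd hq (by simp [hq.dvd_mul, *]))
  obtain ⟨r₁, s₁, hrs₁⟩ := mem_quadraticField_iff.1 (hε₁.2.isUnitOf 0).1
  have hrs₁ : ε₁ = r₁ + s₁ * √(p₁ : ℝ) := by
    have : (ε₁ : ℂ) = r₁ + s₁ * ((√(p₁ : ℝ) : ℝ) : ℂ) := hrs₁
    exact_mod_cast this
  rw [mul_assoc] at hε₃ hxy
  have hef : ((D.e * D.f : biquadraticField p₁ (p₂ * q)) : ℂ) =
      (√((p₁ * (p₂ * q) : ℕ) : ℝ) : ℝ) := by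
    push_cast
    rw [he, hf, ← Complex.ofReal_mul, ← Real.sqrt_mul (by positivity)]
    push_cast
    rfl
  have H : D.HasFundUnits r₁ s₁ a b x y :=
    ⟨isQuadFundUnit_of_isFundamentalUnit hι he D.σ_e hε₁ hrs₁,
      isQuadFundUnit_of_isFundamentalUnit hι hf D.τ_f hε₂ hab,
      isQuadFundUnit_of_isFundamentalUnit hι hef (by rw [map_mul, D.σ_e, D.σ_f, neg_mul]) hε₃ hxy⟩
  have T := H.isUnitTriple hp₁ hp₁4 hq hq4 rfl hq2
  have n₂ := H.snd.norm_eq_one hq hq4 rfl hq2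
  have n₃ := H.trd.norm_eq_one hq hq4 (d' := p₁ * p₂) (by ring) (by simp [hq.dvd_mul, *])
  have R : IsUnitTriple.Realizes (F := biquadraticField p₁ (p₂ * q)) (r₁ + s₁ * D.e) (a + b * D.f)
      (x + y * (D.e * D.f)) ε₁ ε₂ ε₃ :=
    { coe₁ := by push_cast; rw [he, hrs₁]; push_cast; rfl
      coe₂ := by push_cast; rw [hf, hab]; push_cast; rfl
      coe₃ := by rw [hxy]; push_cast at hef ⊢; rw [hef]
      unit₁ := H.fst.isUnit
      unit₂ := H.snd.isUnit
      unit₃ := H.trd.isUnit }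
  obtain ⟨nsq2, nsqp, nsq2p⟩ :=
    D.not_isSquare_two_prime hp₁ hp₂ hq hne hp₁4 hp₂4 hq4
  have he2 := D.e_sq
  have hf2 : D.f ^ 2 = (p₂ : biquadraticField p₁ (p₂ * q)) * q := by rw [D.f_sq]; push_cast; rfl
  have hp₂0 : (p₂ : biquadraticField p₁ (p₂ * q)) ≠ 0 := by exact_mod_cast hp₂.ne_zero
  have class₂ {c : ℕ} (hc : c ≠ 0) (h : PMSq c a) := H.snd.exists_eq_two_mul_sq hn0 n₂ hc h
  have class₃ {c : ℕ} (hc : c ≠ 0) (h : PMSq c x) := H.trd.exists_eq_two_mul_sq hmn0 n₃ hc h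
  have alt₂ (h : ¬ PMSq 1 a) := H.snd.exists_eq_mul_sq hp₂ hq rfl n₂ h
  -- From here on only the square classes of E₂, E₃ and the Galois action matter, not the
  -- coordinates.
  generalize (r₁ + s₁ * D.e : biquadraticField p₁ (p₂ * q)) = E₁ at T R
  generalize (a + b * D.f : biquadraticField p₁ (p₂ * q)) = E₂ at T R class₂ alt₂
  generalize (x + y * (D.e * D.f) : biquadraticField p₁ (p₂ * q)) = E₃ at T R class₃
  have z₂ := T.snd_ne_zero
  have z₃ := T.trd_ne_zero
  have z₂₃ := mul_ne_zero z₂ z₃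
  have t0 : (2 : biquadraticField p₁ (p₂ * q)) ≠ 0 := two_ne_zero
  -- classes of the units modulo squares
  have a1 (h : PMSq 1 a) : ∃ g, E₂ = 2 * g ^ 2 := by
    obtain ⟨g, hg⟩ := class₂ one_ne_zero h
    exact ⟨g, by rw [hg]; push_cast; ring⟩
  have ap (h : PMSq p₂ a) : ∃ g, E₂ = 2 * p₂ * g ^ 2 := class₂ hp₂.ne_zero h
  have a2p (h : PMSq (2 * p₂) a) : ∃ g, E₂ = p₂ * g ^ 2 := by
    obtain ⟨g, hg⟩ := class₂ (mul_ne_zero two_ne_zero hp₂.ne_zero) h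
    exact ⟨2 * g, by rw [hg]; push_cast; ring⟩
  have x1 (h : PMSq 1 x ∨ PMSq p₁ x) : ∃ g, E₃ = 2 * g ^ 2 := by
    rcases h with h | h
    · obtain ⟨g, hg⟩ := class₃ one_ne_zero h
      exact ⟨g, by rw [hg]; push_cast; ring⟩
    · obtain ⟨g, hg⟩ := class₃ hp₁.ne_zero h
      -- The factor p₁ = e² is a square in F.
      exact ⟨D.e * g, by rw [hg, ← he2]; ring⟩
  have x2 (h : PMSq (2 * p₁) x) : ∃ g, E₃ = g ^ 2 := by
    obtain ⟨g, hg⟩ := class₃ (mul_ne_zero two_ne_zero hp₁.ne_zero) h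
    exact ⟨2 * D.e * g, by rw [hg]; push_cast; rw [← he2]; ring⟩
  -- Since p₂q = f², the primes p₂ and q have the same class.
  have hqp : (q : biquadraticField p₁ (p₂ * q)) = p₂ * (D.f / p₂) ^ 2 := by
    rw [div_pow, hf2]; field_simp
  have xp (h : PMSq p₂ x ∨ PMSq q x) : ∃ g, E₃ = 2 * p₂ * g ^ 2 := by
    rcases h with h | h
    · exact class₃ hp₂.ne_zero h
    · obtain ⟨g, hg⟩ := class₃ hq.ne_zero h
      exact ⟨D.f / p₂ * g, by rw [hg, hqp]; ring⟩
  have x2p (h : PMSq (2 * p₂) x ∨ PMSq (2 * q) x) : ∃ g, E₃ = p₂ * g ^ 2 := by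
    rcases h with h | h
    · obtain ⟨g, hg⟩ := class₃ (mul_ne_zero two_ne_zero hp₂.ne_zero) h
      exact ⟨2 * g, by rw [hg]; push_cast; ring⟩
    · obtain ⟨g, hg⟩ := class₃ (mul_ne_zero two_ne_zero hq.ne_zero) h
      exact ⟨2 * (D.f / p₂ * g), by rw [hg]; push_cast; rw [hqp]; ring⟩
  -- In each case, which of E₂, E₃, E₂E₃ have trivial class determines the third generator of the
  -- units of F; one of them having the class of 2 gives a unit √(i·) of K and index 2, and if none
  -- has it the index is 1.
  refine ⟨?_, ?_, ?_, ?_, ?_, ?_, ?_⟩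
  · rintro ⟨h₂, h₃⟩
    obtain ⟨g, hg⟩ := a1 h₂
    obtain ⟨k, hk⟩ := x1 h₃
    exact (R.isThirdGenerator_sqrt_mul T hι (not_isSquare_of_eq_mul_sq z₂ nsq2 hg)
      (not_isSquare_of_eq_mul_sq z₃ nsq2 hk) ⟨2 * g * k, by rw [hg, hk]; ring⟩ hr₂₃).index_two
      R T hι hG nsq2 ⟨2 * g, by rw [hg]; ring⟩ hs₂
  · rintro ⟨h₃, h₂⟩
    obtain ⟨k, hk⟩ := x1 h₃
    refine (R.isThirdGenerator T hι ?_ (not_isSquare_of_eq_mul_sq z₃ nsq2 hk) ?_).index_two'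
      R T hι hG nsq2 (j := 0) ⟨2 * k, by rw [hk]; ring⟩ (by simpa using hs₃)
    -- E₂ has class p₂ or 2p₂ and E₃ has class 2, so E₂E₃ has class 2p₂ or p₂.
    all_goals obtain ⟨g, hg⟩ | ⟨g, hg⟩ := alt₂ h₂
    · exact not_isSquare_of_eq_mul_sq z₂ nsqp hg
    · exact not_isSquare_of_eq_mul_sq z₂ nsq2p hg
    · exact not_isSquare_of_eq_mul_sq z₂₃ nsq2p (g := g * k) (by rw [hg, hk]; ring)
    · exact not_isSquare_of_eq_mul_sq z₂₃ nsqp (g := 2 * g * k) (by rw [hg, hk]; ring)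
  · rintro ⟨h₂, h₃⟩
    obtain ⟨g, hg⟩ := a1 h₂
    obtain ⟨k, hk⟩ := x2 h₃
    exact (R.isThirdGenerator_sqrt T hι (not_isSquare_of_eq_mul_sq z₂ nsq2 hg)
      (not_isSquare_of_eq_mul_sq z₂₃ nsq2 (g := g * k) (by rw [hg, hk]; ring))
      ⟨k, by rw [hk, sq]⟩ hr₃).index_two R T hι hG nsq2 ⟨2 * g, by rw [hg]; ring⟩ hs₂
  · rintro ⟨h₃, h₂⟩
    obtain ⟨k, hk⟩ := x2 h₃
    have hsq : IsSquare E₃ := ⟨k, by rw [hk, sq]⟩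
    refine (R.isThirdGenerator_sqrt T hι ?_ ?_ hsq hr₃).index_one R T hι hG nsq2 ?_
      (not_isSquare_of_eq_mul_sq (mul_ne_zero t0 z₃) nsq2 (g := k) (by rw [hk])) ?_
    all_goals obtain ⟨g, hg⟩ | ⟨g, hg⟩ := alt₂ h₂
    · exact not_isSquare_of_eq_mul_sq z₂ nsqp hg
    · exact not_isSquare_of_eq_mul_sq z₂ nsq2p hg
    · exact not_isSquare_of_eq_mul_sq z₂₃ nsqp (g := g * k) (by rw [hg, hk]; ring)
    · exact not_isSquare_of_eq_mul_sq z₂₃ nsq2p (g := g * k) (by rw [hg, hk]; ring)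
    · exact not_isSquare_of_eq_mul_sq (mul_ne_zero t0 z₂) nsq2p (g := g) (by rw [hg]; ring)
    · exact not_isSquare_of_eq_mul_sq (mul_ne_zero t0 z₂) nsqp (g := 2 * g) (by rw [hg]; ring)
    · exact not_isSquare_of_eq_mul_sq (mul_ne_zero t0 z₂₃) nsq2p (g := g * k)
        (by rw [hg, hk]; ring)
    · exact not_isSquare_of_eq_mul_sq (mul_ne_zero t0 z₂₃) nsqp (g := 2 * g * k)
        (by rw [hg, hk]; ring)
  · intro h
    have h₂ : PMSq 1 a := h.elim (·.1) (·.1)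
    have h₃ : (∃ k, E₃ = 2 * p₂ * k ^ 2) ∨ ∃ k, E₃ = p₂ * k ^ 2 := by
      rcases h with ⟨-, h | h⟩ | ⟨-, h | h⟩
      exacts [.inl (xp (.inl h)), .inr (x2p (.inl h)), .inl (xp (.inr h)), .inr (x2p (.inr h))]
    obtain ⟨g, hg⟩ := a1 h₂
    refine (R.isThirdGenerator T hι (not_isSquare_of_eq_mul_sq z₂ nsq2 hg) ?_ ?_).index_two
      R T hι hG nsq2 ⟨2 * g, by rw [hg]; ring⟩ hs₂
    all_goals obtain ⟨k, hk⟩ | ⟨k, hk⟩ := h₃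
    · exact not_isSquare_of_eq_mul_sq z₃ nsq2p hk
    · exact not_isSquare_of_eq_mul_sq z₃ nsqp hk
    · exact not_isSquare_of_eq_mul_sq z₂₃ nsqp (g := 2 * g * k) (by rw [hg, hk]; ring)
    · exact not_isSquare_of_eq_mul_sq z₂₃ nsq2p (g := g * k) (by rw [hg, hk]; ring)
  · rintro (⟨h₂, h₃⟩ | ⟨h₂, h₃⟩)
    · obtain ⟨g, hg⟩ := ap h₂
      obtain ⟨k, hk⟩ := xp h₃
      exact (R.isThirdGenerator_sqrt_mul T hι (not_isSquare_of_eq_mul_sq z₂ nsq2p hg)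
        (not_isSquare_of_eq_mul_sq z₃ nsq2p hk) ⟨2 * p₂ * g * k, by rw [hg, hk]; ring⟩
        hr₂₃).index_one R T hι hG nsq2
        (not_isSquare_of_eq_mul_sq (mul_ne_zero t0 z₂) nsqp (g := 2 * g) (by rw [hg]; ring))
        (not_isSquare_of_eq_mul_sq (mul_ne_zero t0 z₃) nsqp (g := 2 * k) (by rw [hk]; ring))
        (not_isSquare_of_eq_mul_sq (mul_ne_zero t0 z₂₃) nsq2 (g := 2 * p₂ * g * k)
          (by rw [hg, hk]; ring))
    · obtain ⟨g, hg⟩ := a2p h₂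
      obtain ⟨k, hk⟩ := x2p h₃
      exact (R.isThirdGenerator_sqrt_mul T hι (not_isSquare_of_eq_mul_sq z₂ nsqp hg)
        (not_isSquare_of_eq_mul_sq z₃ nsqp hk) ⟨p₂ * g * k, by rw [hg, hk]; ring⟩
        hr₂₃).index_one R T hι hG nsq2
        (not_isSquare_of_eq_mul_sq (mul_ne_zero t0 z₂) nsq2p (g := g) (by rw [hg]; ring))
        (not_isSquare_of_eq_mul_sq (mul_ne_zero t0 z₃) nsq2p (g := k) (by rw [hk]; ring))
        (not_isSquare_of_eq_mul_sq (mul_ne_zero t0 z₂₃) nsq2 (g := p₂ * g * k)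
          (by rw [hg, hk]; ring))
  · rintro (⟨h₂, h₃⟩ | ⟨h₂, h₃⟩)
    · obtain ⟨g, hg⟩ := ap h₂
      obtain ⟨k, hk⟩ := x2p h₃
      exact (R.isThirdGenerator T hι (not_isSquare_of_eq_mul_sq z₂ nsq2p hg)
        (not_isSquare_of_eq_mul_sq z₃ nsqp hk) (not_isSquare_of_eq_mul_sq z₂₃ nsq2
          (g := p₂ * g * k) (by rw [hg, hk]; ring))).index_two' R T hι hG nsq2 (j := 1)
        ⟨2 * p₂ * g * k, by rw [hg, hk]; ring⟩ (by simpa using hs₂₃)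
    · obtain ⟨g, hg⟩ := a2p h₂
      obtain ⟨k, hk⟩ := xp h₃
      exact (R.isThirdGenerator T hι (not_isSquare_of_eq_mul_sq z₂ nsqp hg)
        (not_isSquare_of_eq_mul_sq z₃ nsq2p hk) (not_isSquare_of_eq_mul_sq z₂₃ nsq2
          (g := p₂ * g * k) (by rw [hg, hk]; ring))).index_two' R T hι hG nsq2 (j := 1)
        ⟨2 * p₂ * g * k, by rw [hg, hk]; ring⟩ (by simpa using hs₂₃)
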